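/- Fix an integer $n\ge 1$ and constants $c_1,c_2\ge 0$. Let $\mathcal L(c_1,c_2)$ be the class of laws of random variables $u(N)$, where $N$ is standard Gaussian and $u:\mathbb R\to\mathbb R$ is twice continuously differentiable with $|u'(x)|\le c_1$ and $|u''(x)|\le c_2$ for all $x\in\mathbb R$. Let $(X_{ij})_{1\le i\le j\le n}$ be independent real random variables whose laws all belong to $\mathcal L(c_1,c_2)$, put $X_{ij}=X_{ji}$ for $i>j$, and let $A=\frac1{\sqrt n}(X_{ij})_{1\le i,j\le n}$ be the corresponding Wigner matrix. Let $f(z)=\sum_{m\ge 0}b_mz^m$ be an entire function, $f(A)=\sum_{m\ge 0}b_mA^m$, and $$f_1(z)=\sum_{m\ge 1}m|b_m|z^{m-1},\qquad f_2(z)=\sum_{m\ge 2}m(m-1)|b_m|z^{m-2}.$$ Let $\lambda$ be the spectral radius of $A$, and let $a=(\mathbb E f_1(\lambda)^4)^{1/4}$ and $b=(\mathbb E f_2(\lambda)^4)^{1/4}$, as elements of $[0,\infty]$. Suppose that $W=\operatorname{Re}\operatorname{Tr}f(A)$ has finite fourth moment, let $\sigma^2=\operatorname{Var}(W)$, and let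 $Z$ be a normal random variable with the same mean and variance as $W$. Then $$\sup_{B\subseteq\mathbb R\text{ Borel}}|\mathbb P(W\in B)-\mathbb P(Z\in B)|=:d_{TV}(W,Z)\le\frac{2\sqrt5}{\sigma^2}\left(\frac{4c_1c_2a^2}{\sqrt n}+\frac{8c_1^3ab}{n}\right),$$ with the convention $0\cdot\infty=0$ on the right. (In the degenerate case $\sigma^2=0$, $Z$ is the constant $\mathbb E W$ and the assertion is that $d_{TV}(W,Z)=0$.) -/

import Mathlib

open MeasureTheory ProbabilityTheory
open scoped ENNReal

namespace WignerCLT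

noncomputable section

/-- The class `𝓛(c₁, c₂)` of laws of `u(Z)`, where `Z` is a standard gaussian random variable and
`u : ℝ → ℝ` is twice continuously differentiable with `|u'| ≤ c₁` and `|u''| ≤ c₂` everywhere. -/
def lawClass (c₁ c₂ : ℝ) : Set (Measure ℝ) :=
  {ν | ∃ u : ℝ → ℝ, ContDiff ℝ 2 u ∧ (∀ x, |deriv u x| ≤ c₁) ∧
    (∀ x, |deriv (deriv u) x| ≤ c₂) ∧ ν = (gaussianReal 0 1).map u}

/-- Total variation distance between two probability measures on `ℝ`: the supremum of
`|μ(B) - ν(B)|` over all Borel sets `B`. -/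
def tvDist (μ ν : Measure ℝ) : ℝ≥0∞ :=
  ⨆ (B : Set ℝ) (_ : MeasurableSet B), ENNReal.ofReal |μ.real B - ν.real B|

/-- The index set `{(i, j) : i ≤ j}` of the independent entries of a symmetric matrix. -/
abbrev UpperIndex (n : ℕ) : Type := {p : Fin n × Fin n // p.1 ≤ p.2}

/-- The Wigner matrix: the symmetric matrix whose `(i, j)` and `(j, i)` entries, `i ≤ j`, are
`x_{ij} / √n`. -/
def wignerMatrix (n : ℕ) (x : UpperIndex n → ℝ) : Matrix (Fin n) (Fin n) ℂ :=
  Matrix.of fun i j => ((x ⟨(min i j, max i j), min_le_max⟩ / √(n : ℝ) : ℝ) : ℂ)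

/-- The `m`-th coefficient `b_m` of the power series `f(z) = ∑ b_m z ^ m` of an entire `f`. -/
def coeff (f : ℂ → ℂ) (m : ℕ) : ℂ := iteratedDeriv m f 0 / (m.factorial : ℂ)

/-- `f(A) = ∑ b_m A ^ m` for an entire function `f` and a square matrix `A`. -/
def matrixFun {n : ℕ} (f : ℂ → ℂ) (A : Matrix (Fin n) (Fin n) ℂ) : Matrix (Fin n) (Fin n) ℂ :=
  ∑' m : ℕ, coeff f m • A ^ m

/-- `f₁(x) = ∑_{m ≥ 1} m |b_m| x ^ (m - 1)`; the term `m = 0` vanishes. -/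
def f₁ (f : ℂ → ℂ) (x : ℝ) : ℝ :=
  ∑' m : ℕ, (m : ℝ) * ‖coeff f m‖ * x ^ (m - 1)

/-- `f₂(x) = ∑_{m ≥ 2} m (m - 1) |b_m| x ^ (m - 2)`; the terms `m = 0, 1` vanish. -/
def f₂ (f : ℂ → ℂ) (x : ℝ) : ℝ :=
  ∑' m : ℕ, (m : ℝ) * ((m : ℝ) - 1) * ‖coeff f m‖ * x ^ (m - 2)

/-- The spectral radius of a complex square matrix, as a real number: the largest modulus of an
eigenvalue. -/
def specRadius {n : ℕ} (A : Matrix (Fin n) (Fin n) ℂ) : ℝ := (spectralRadius ℂ A).toReal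

/-- The linear statistic `Re Tr f(A)`. -/
def linStat {n : ℕ} (f : ℂ → ℂ) (A : Matrix (Fin n) (Fin n) ℂ) : ℝ := (matrixFun f A).trace.re

end

end WignerCLT

/-! Write W = h(X) with X a standard gaussian vector: the entries are u_k(X_k), and h is Re Tr f of
the matrix they form. The theorem is an instance of a second order Poincaré inequality: W is nearly
normal when Hess h applied to ∇h is small compared with the variance.

Interpolate between X and an independent copy Y by X_θ = cos θ X + sin θ Y. The difference h(Y) -
h(X) is the integral of ⟨∇h(X_θ), X_θ'⟩ over [0, π/2]. The pair (X_θ, X_θ') is again standard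
gaussian and X = cos θ X_θ - sin θ X_θ', so integrating by parts in X_θ' expresses Cov(φ(W), W) as
the integral of sin θ E[φ'(W) Γ_θ], where Γ_θ = ⟨∇h(X), ∇h(X_θ)⟩
(`covariance_eq_integral_rotation`). The choice φ = id gives σ². Hence σ² E φ'(W) - Cov(φ(W), W) is
at most sup|φ'| times the L¹ fluctuation of Γ_θ. The same rotation argument, applied to the gaussian
law of (X, X_θ), gives an L¹ Poincaré inequality with constant π/2. The gradient of Γ_θ has two
halves, each contributing at most a bound K for E|Hess h · ∇h|, so the fluctuation is at most πK
(`abs_variance_mul_sub_covariance_le`). Solutions of Stein's equation satisfy |φ'| ≤ 2, whence the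
distance is at most 2πK/σ² (`tvDist_map_gaussianReal_le`).

It remains to estimate K. The matrix is Hermitian, so λ is its operator norm. The linear map M from
upper triangular vectors to matrices satisfies ‖M(v)‖² ≤ (2/n)|v|² in Hilbert–Schmidt norm. This
gives |∇h| ≤ √2 c₁ f₁(λ). The Hessian is a diagonal part carrying u'', of size 2 c₂ f₁(λ)/√n, plus a
part of size (2/n) c₁² f₂(λ), obtained by putting the powers of A in operator norm and the two
directions in Hilbert–Schmidt norm (`hessGradNorm_gaussGrad_le`). Cauchy–Schwarz, using only the
marginals of (X, X_θ), bounds the resulting products by a² and ab, and π√2 ≤ 2√5 gives the stated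
constants. -/

namespace WignerCLT

noncomputable section

/-! ### Standard gaussian vectors and integration by parts -/

section GaussianBasics

/-- Integrability with respect to the standard gaussian measure, in terms of the density. -/
lemma integrable_gaussianReal_iff (f : ℝ → ℝ) :
    Integrable f (gaussianReal 0 1) ↔ Integrable fun t => gaussianPDFReal 0 1 t * f t := by
  rw [gaussianReal_of_var_ne_zero 0 one_ne_zero,
    integrable_withDensity_iff_integrable_smul' (measurable_gaussianPDF 0 1)
      (ae_of_all _ fun _ => gaussianPDF_lt_top)]
  simp only [toReal_gaussianPDF, smul_eq_mul]

lemma hasDerivAt_gaussianPDFReal (t : ℝ) :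
    HasDerivAt (gaussianPDFReal 0 1) (-t * gaussianPDFReal 0 1 t) t := by
  have h : gaussianPDFReal 0 1 = fun x => (√(2 * Real.pi))⁻¹ * Real.exp (-x ^ 2 / 2) := by
    ext x; simp [gaussianPDFReal]
  rw [h]
  have h1 : HasDerivAt (fun x : ℝ => -x ^ 2 / 2) (-t) t := by
    have := ((hasDerivAt_pow 2 t).fun_neg).div_const 2
    refine this.congr_deriv ?_
    push_cast
    ring
  refine (h1.exp.const_mul (√(2 * Real.pi))⁻¹).congr_deriv ?_
  ring

/-- Stein's identity for the standard gaussian measure. -/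
lemma integral_mul_id_gaussianReal {f f' : ℝ → ℝ} (hf : ∀ t, HasDerivAt f (f' t) t)
    (h0 : Integrable f (gaussianReal 0 1))
    (h1 : Integrable (fun t => f t * t) (gaussianReal 0 1))
    (h2 : Integrable f' (gaussianReal 0 1)) :
    ∫ t, f t * t ∂gaussianReal 0 1 = ∫ t, f' t ∂gaussianReal 0 1 := by
  rw [integrable_gaussianReal_iff] at h0 h1 h2
  rw [integral_gaussianReal_eq_integral_smul one_ne_zero,
    integral_gaussianReal_eq_integral_smul one_ne_zero]
  have := integral_mul_deriv_eq_deriv_mul_of_integrable (u := f) (v := gaussianPDFReal 0 1)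
    (fun x _ => hf x) (fun x _ => hasDerivAt_gaussianPDFReal x)
    (h1.neg.congr (ae_of_all _ fun t => by simp only [Pi.neg_apply, Pi.mul_apply]; ring))
    (h2.congr (ae_of_all _ fun t => by simp only [Pi.mul_apply]; ring))
    (h0.congr (ae_of_all _ fun t => by simp only [Pi.mul_apply]; ring))
  calc ∫ t, gaussianPDFReal 0 1 t • (f t * t)
      = - ∫ t, f t * (-t * gaussianPDFReal 0 1 t) := by
        rw [← integral_neg]; congr 1; ext t; simp only [smul_eq_mul]; ring
    _ = ∫ t, gaussianPDFReal 0 1 t • f' t := by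
        rw [this, neg_neg]; congr 1; ext t; simp only [smul_eq_mul]; ring

variable (ι : Type*) [Fintype ι]

/-- The standard gaussian measure on `ι → ℝ`. -/
def stdGaussianPi : Measure (ι → ℝ) := Measure.pi fun _ => gaussianReal 0 1

instance : IsProbabilityMeasure (stdGaussianPi ι) := by
  unfold stdGaussianPi; infer_instance

/-- Rotation invariance of a pair of independent copies is a property of centred gaussian measures,
so the product measure has to be recognised as one. -/
instance isGaussian_stdGaussianPi : IsGaussian (stdGaussianPi ι) := by
  have h2 : iIndepFun (fun (i : ι) (x : ι → ℝ) => x i) (stdGaussianPi ι) :=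
    iIndepFun_pi (μ := fun _ : ι => gaussianReal 0 1) (X := fun _ => id)
      (fun _ => aemeasurable_id)
  have h1 : ∀ i, HasGaussianLaw (fun x : ι → ℝ => x i) (stdGaussianPi ι) := fun i => by
    refine ⟨?_⟩
    have : (stdGaussianPi ι).map (fun x : ι → ℝ => x i) = gaussianReal 0 1 :=
      (measurePreserving_eval (fun _ : ι => gaussianReal 0 1) i).map_eq
    rw [this]; infer_instance
  have := (iIndepFun.hasGaussianLaw h1 h2).isGaussian_map
  have hid : (fun (ω : ι → ℝ) (i : ι) => ω i) = id := rfl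
  rwa [hid, Measure.map_id] at this

variable {ι}

lemma measurePreserving_eval_stdGaussianPi (i : ι) :
    MeasurePreserving (fun x : ι → ℝ => x i) (stdGaussianPi ι) (gaussianReal 0 1) :=
  measurePreserving_eval (fun _ : ι => gaussianReal 0 1) i

lemma memLp_eval_stdGaussianPi (i : ι) (p : ℝ≥0∞) (hp : p ≠ ∞) :
    MemLp (fun x : ι → ℝ => x i) p (stdGaussianPi ι) :=
  (memLp_id_gaussianReal' p hp).comp_measurePreserving (measurePreserving_eval_stdGaussianPi i)

lemma integral_id_stdGaussianPi : (stdGaussianPi ι)[id] = 0 := by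
  ext i
  have hint : Integrable (id : (ι → ℝ) → ι → ℝ) (stdGaussianPi ι) := IsGaussian.integrable_id
  have := (ContinuousLinearMap.proj (R := ℝ) (φ := fun _ : ι => ℝ) i).integral_comp_comm hint
  simp only [ContinuousLinearMap.proj_apply, id] at this
  simp only [id, Pi.zero_apply]
  rw [← this]
  have h3 := integral_map (μ := stdGaussianPi ι) (φ := fun x : ι → ℝ => x i) (f := fun t : ℝ => t)
    (measurable_pi_apply i).aemeasurable (by fun_prop)
  rw [(measurePreserving_eval_stdGaussianPi i).map_eq] at h3
  rw [← h3, integral_id_gaussianReal]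

/-- Resampling one coordinate preserves the standard gaussian measure. -/
lemma measurePreserving_update_stdGaussianPi [DecidableEq ι] (i : ι) :
    MeasurePreserving (fun p : (ι → ℝ) × ℝ => Function.update p.1 i p.2)
      ((stdGaussianPi ι).prod (gaussianReal 0 1)) (stdGaussianPi ι) := by
  have hm : Measurable (fun p : (ι → ℝ) × ℝ => Function.update p.1 i p.2) := by
    refine measurable_pi_lambda _ fun j => ?_
    by_cases h : j = i
    · subst h; simpa using measurable_snd
    · simp only [Function.update_of_ne h]; fun_prop
  refine ⟨hm, ?_⟩
  unfold stdGaussianPi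
  refine (Measure.pi_eq fun s hs => ?_).symm
  rw [Measure.map_apply hm (.univ_pi hs)]
  have : (fun p : (ι → ℝ) × ℝ => Function.update p.1 i p.2) ⁻¹' (Set.univ.pi s) =
      (Set.univ.pi (Function.update s i Set.univ)) ×ˢ s i := by
    ext ⟨x, t⟩
    simp only [Set.mem_preimage, Set.mem_univ_pi, Set.mem_prod]
    constructor
    · intro h
      refine ⟨fun j => ?_, by simpa using h i⟩
      by_cases hj : j = i
      · subst hj; simp
      · simpa [hj] using h j
    · rintro ⟨h, h'⟩ j
      by_cases hj : j = i
      · subst hj; simpa using h'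
      · simpa [hj] using h j
  rw [this, Measure.prod_prod, Measure.pi_pi, ← Finset.prod_erase_mul _ _ (Finset.mem_univ i),
    ← Finset.prod_erase_mul _ (fun j => gaussianReal 0 1 (s j)) (Finset.mem_univ i)]
  simp only [Function.update_self, measure_univ, mul_one]
  congr 1
  refine Finset.prod_congr rfl fun j hj => ?_
  rw [Function.update_of_ne (Finset.ne_of_mem_erase hj)]

/-- Gaussian integration by parts in one coordinate of the second factor of a product. -/
lemma integral_mul_coord_eq {S : Type*} [MeasurableSpace S] (ρ : Measure S) [SFinite ρ]
    [DecidableEq ι] (i : ι) {Ψ Ψ' : S × (ι → ℝ) → ℝ}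
    (hΨ : ∀ s q t, HasDerivAt (fun t => Ψ (s, Function.update q i t))
      (Ψ' (s, Function.update q i t)) t)
    (h0 : Integrable Ψ (ρ.prod (stdGaussianPi ι)))
    (h1 : Integrable (fun z => Ψ z * z.2 i) (ρ.prod (stdGaussianPi ι)))
    (h2 : Integrable Ψ' (ρ.prod (stdGaussianPi ι))) :
    ∫ z, Ψ z * z.2 i ∂ρ.prod (stdGaussianPi ι) = ∫ z, Ψ' z ∂ρ.prod (stdGaussianPi ι) := by
  have hmp0 := (MeasurePreserving.id ρ).prod (measurePreserving_update_stdGaussianPi i)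
  have hmp : MeasurePreserving (fun p : (S × (ι → ℝ)) × ℝ => (p.1.1, Function.update p.1.2 i p.2))
      ((ρ.prod (stdGaussianPi ι)).prod (gaussianReal 0 1)) (ρ.prod (stdGaussianPi ι)) :=
    hmp0.comp (measurePreserving_prodAssoc ρ (stdGaussianPi ι) (gaussianReal 0 1))
  -- Resampling the coordinate leaves the law unchanged, so every integral can be computed by
  -- averaging over that coordinate first; the claim then reduces to the one-dimensional identity.
  have key : ∀ F : S × (ι → ℝ) → ℝ, Integrable F (ρ.prod (stdGaussianPi ι)) →
      ∫ z, F z ∂ρ.prod (stdGaussianPi ι) =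
        ∫ w, ∫ t, F (w.1, Function.update w.2 i t) ∂gaussianReal 0 1 ∂ρ.prod (stdGaussianPi ι) := by
    intro F hF
    have hF' := hmp.integrable_comp_of_integrable hF
    rw [← integral_prod (f := fun p : (S × (ι → ℝ)) × ℝ => F (p.1.1, Function.update p.1.2 i p.2))
      hF', ← integral_map hmp.measurable.aemeasurable, hmp.map_eq]
    rw [hmp.map_eq]; exact hF.aestronglyMeasurable
  rw [key _ h1, key _ h2]
  have a0 := (hmp.integrable_comp_of_integrable h0).prod_right_ae
  have a1 := (hmp.integrable_comp_of_integrable h1).prod_right_ae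
  have a2 := (hmp.integrable_comp_of_integrable h2).prod_right_ae
  refine integral_congr_ae ?_
  filter_upwards [a0, a1, a2] with w w0 w1 w2
  simp only [Function.comp_def, Function.update_self] at w0 w1 w2 ⊢
  exact integral_mul_id_gaussianReal (hΨ w.1 w.2) w0 w1 w2

end GaussianBasics

/-! ### Covariance by rotation of two independent copies -/

section Covariance

open ContinuousLinearMap (rotation)

lemma rotation_neg_rotation {E : Type*} [SeminormedAddCommGroup E] [NormedSpace ℝ E] (θ : ℝ)
    (z : E × E) : rotation (-θ) (rotation θ z) = z := by
  have h := Real.sin_sq_add_cos_sq θ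
  ext1
  · simp only [ContinuousLinearMap.rotation_apply, Real.cos_neg, Real.sin_neg]
    calc _ = (Real.sin θ ^ 2 + Real.cos θ ^ 2) • z.1 := by module
      _ = z.1 := by rw [h, one_smul]
  · simp only [ContinuousLinearMap.rotation_apply, Real.cos_neg, Real.sin_neg]
    calc _ = (Real.sin θ ^ 2 + Real.cos θ ^ 2) • z.2 := by module
      _ = z.2 := by rw [h, one_smul]

lemma continuous_rotation {E : Type*} [SeminormedAddCommGroup E] [NormedSpace ℝ E] :
    Continuous fun p : ℝ × (E × E) => rotation p.1 p.2 := by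
  simp only [ContinuousLinearMap.rotation_apply]
  fun_prop

lemma measurePreserving_rotation {F : Type*} [NormedAddCommGroup F] [NormedSpace ℝ F]
    [SecondCountableTopology F] [CompleteSpace F] [MeasurableSpace F] [BorelSpace F]
    {μ : Measure F} [IsGaussian μ] (hμ : μ[id] = 0) (θ : ℝ) :
    MeasurePreserving (rotation θ) (μ.prod μ) (μ.prod μ) :=
  ⟨(rotation (E := F) θ).continuous.measurable, IsGaussian.map_rotation_eq_self hμ θ⟩

/-- The angle and the rotated pair, when the angle itself is distributed according to `ν`. -/
lemma measurePreserving_prod_rotation {F : Type*} [NormedAddCommGroup F] [NormedSpace ℝ F]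
    [SecondCountableTopology F] [CompleteSpace F] [MeasurableSpace F] [BorelSpace F]
    {μ : Measure F} [IsGaussian μ] (hμ : μ[id] = 0) (ν : Measure ℝ) [SFinite ν] :
    MeasurePreserving (fun p : ℝ × (F × F) => (p.1, rotation p.1 p.2))
      (ν.prod (μ.prod μ)) (ν.prod (μ.prod μ)) :=
  (MeasurePreserving.id ν).skew_product (g := fun θ z => rotation θ z)
    continuous_rotation.measurable
    (ae_of_all _ fun θ => (measurePreserving_rotation hμ θ).map_eq)

lemma hasDerivAt_rotation_fst {E : Type*} [NormedAddCommGroup E] [NormedSpace ℝ E] (z : E × E)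
    (θ : ℝ) : HasDerivAt (fun θ => (rotation θ z).1) (rotation θ z).2 θ := by
  simp only [ContinuousLinearMap.rotation_apply]
  exact ((Real.hasDerivAt_cos θ).smul_const z.1).add ((Real.hasDerivAt_sin θ).smul_const z.2)

@[simp] lemma rotation_zero_fst {E : Type*} [NormedAddCommGroup E] [NormedSpace ℝ E] (z : E × E) :
    (rotation 0 z).1 = z.1 := by simp [ContinuousLinearMap.rotation_apply]

@[simp] lemma rotation_pi_div_two_fst {E : Type*} [NormedAddCommGroup E] [NormedSpace ℝ E]
    (z : E × E) : (rotation (Real.pi / 2) z).1 = z.2 := by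
  simp [ContinuousLinearMap.rotation_apply]

variable {ι : Type*} [Fintype ι]

lemma measurePreserving_rotation_stdGaussianPi (θ : ℝ) :
    MeasurePreserving (rotation (E := ι → ℝ) θ) ((stdGaussianPi ι).prod (stdGaussianPi ι))
      ((stdGaussianPi ι).prod (stdGaussianPi ι)) :=
  measurePreserving_rotation integral_id_stdGaussianPi θ

/-- Products of independent square integrable functions are square integrable. -/
lemma memLp_two_mul_prod {α β : Type*} [MeasurableSpace α] [MeasurableSpace β] {μ : Measure α}
    {ν : Measure β} [SFinite μ] [SFinite ν] {f : α → ℝ} {g : β → ℝ} (hf : MemLp f 2 μ)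
    (hg : MemLp g 2 ν) : MemLp (fun z : α × β => f z.1 * g z.2) 2 (μ.prod ν) := by
  have hm : AEStronglyMeasurable (fun z : α × β => f z.1 * g z.2) (μ.prod ν) :=
    hf.aestronglyMeasurable.comp_fst.mul hg.aestronglyMeasurable.comp_snd
  rw [memLp_two_iff_integrable_sq hm]
  simp only [mul_pow]
  exact hf.integrable_sq.mul_prod hg.integrable_sq

lemma memLp_two_comp_of_deriv_le {α : Type*} [MeasurableSpace α] {μ : Measure α}
    [IsFiniteMeasure μ] {h : α → ℝ} (hh : MemLp h 2 μ) {φ φ' : ℝ → ℝ} {C : ℝ}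
    (hφ : ∀ t, HasDerivAt φ (φ' t) t) (hC : ∀ t, |φ' t| ≤ C) :
    MemLp (fun x => φ (h x)) 2 μ := by
  have hcont : Continuous φ := continuous_iff_continuousAt.2 fun t => (hφ t).continuousAt
  have hb : MemLp (fun x => |φ 0| + C * |h x|) 2 μ :=
    MemLp.add (f := fun _ => |φ 0|) (g := fun x => C * |h x|) (memLp_const _)
      (MemLp.const_mul (f := fun x => |h x|) hh.norm C)
  refine hb.mono' (hcont.comp_aestronglyMeasurable hh.aestronglyMeasurable) (ae_of_all _ fun x => ?_)
  have h1 : ‖φ (h x) - φ 0‖ ≤ C * ‖h x - 0‖ :=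
    Convex.norm_image_sub_le_of_norm_hasDerivWithin_le (s := Set.univ)
      (fun t _ => (hφ t).hasDerivWithinAt) (fun t _ => hC t) convex_univ trivial trivial
  rw [sub_zero, Real.norm_eq_abs, Real.norm_eq_abs] at h1
  calc ‖φ (h x)‖ = |φ 0 + (φ (h x) - φ 0)| := by rw [Real.norm_eq_abs]; congr 1; ring
    _ ≤ |φ 0| + |φ (h x) - φ 0| := abs_add_le _ _
    _ ≤ _ := by gcongr

variable {h : (ι → ℝ) → ℝ} {d : ι → (ι → ℝ) → ℝ} {φ φ' : ℝ → ℝ} {C : ℝ}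

/-- The integration by parts behind the covariance identity, for a fixed angle. -/
lemma integral_mul_rotation_eq
    (hd : ∀ x, HasFDerivAt h (∑ i, d i x • ContinuousLinearMap.proj (R := ℝ) i) x)
    (hdc : ∀ i, Continuous (d i))
    (hh2 : MemLp h 2 (stdGaussianPi ι)) (hd2 : ∀ i, MemLp (d i) 2 (stdGaussianPi ι))
    (hφ : ∀ t, HasDerivAt φ (φ' t) t) (hφc : Continuous φ') (hC : ∀ t, |φ' t| ≤ C) (θ : ℝ) :
    ∫ z, φ (h z.1) * ∑ i, d i (rotation θ z).1 * (rotation θ z).2 i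
        ∂(stdGaussianPi ι).prod (stdGaussianPi ι) =
      - Real.sin θ * ∫ z, φ' (h z.1) * ∑ i, d i z.1 * d i (rotation θ z).1
        ∂(stdGaussianPi ι).prod (stdGaussianPi ι) := by
  classical
  set γ := stdGaussianPi ι with hγ
  have hrot : MeasurePreserving (rotation (E := ι → ℝ) θ) (γ.prod γ) (γ.prod γ) :=
    measurePreserving_rotation_stdGaussianPi θ
  have hrot' : MeasurePreserving (rotation (E := ι → ℝ) (-θ)) (γ.prod γ) (γ.prod γ) :=
    measurePreserving_rotation_stdGaussianPi (-θ)
  have hfst : MeasurePreserving (fun w : (ι → ℝ) × (ι → ℝ) => (rotation (-θ) w).1)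
      (γ.prod γ) γ := measurePreserving_fst.comp hrot'
  have hhc : Continuous h := continuous_iff_continuousAt.2 fun x => (hd x).continuousAt
  have hφc0 : Continuous φ := continuous_iff_continuousAt.2 fun t => (hφ t).continuousAt
  have hφh : MemLp (fun w : (ι → ℝ) × (ι → ℝ) => φ (h (rotation (-θ) w).1)) 2 (γ.prod γ) :=
    (memLp_two_comp_of_deriv_le hh2 hφ hC).comp_measurePreserving hfst
  have hdi : ∀ i, MemLp (fun w : (ι → ℝ) × (ι → ℝ) => d i (rotation (-θ) w).1) 2 (γ.prod γ) :=
    fun i => (hd2 i).comp_measurePreserving hfst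
  have hdf : ∀ i, MemLp (fun w : (ι → ℝ) × (ι → ℝ) => d i w.1) 2 (γ.prod γ) :=
    fun i => (hd2 i).comp_measurePreserving measurePreserving_fst
  have hdm : ∀ i, MemLp (fun w : (ι → ℝ) × (ι → ℝ) => d i w.1 * w.2 i) 2 (γ.prod γ) :=
    fun i => memLp_two_mul_prod (hd2 i) (memLp_eval_stdGaussianPi i 2 (by simp))
  have i1 : ∀ i, Integrable (fun w : (ι → ℝ) × (ι → ℝ) =>
      d i w.1 * φ (h (rotation (-θ) w).1) * w.2 i) (γ.prod γ) := fun i =>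
    ((hdm i).integrable_mul hφh).congr (ae_of_all _ fun w => by simp only [Pi.mul_apply]; ring)
  have i2 : ∀ i, Integrable (fun w : (ι → ℝ) × (ι → ℝ) =>
      d i w.1 * φ' (h (rotation (-θ) w).1) * d i (rotation (-θ) w).1) (γ.prod γ) := fun i => by
    have : Integrable (fun w : (ι → ℝ) × (ι → ℝ) =>
      φ' (h (rotation (-θ) w).1) * (d i w.1 * d i (rotation (-θ) w).1)) (γ.prod γ) := by
      refine ((hdf i).integrable_mul (hdi i)).bdd_mul (c := C) ?_ (ae_of_all _ fun w => hC _)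
      have := (rotation (E := ι → ℝ) (-θ)).continuous
      exact Continuous.aestronglyMeasurable (by fun_prop)
    exact this.congr (ae_of_all _ fun w => by ring)
  -- In the rotated variables w the original point is cos θ w.1 - sin θ w.2, while `d i w.1` does
  -- not involve w.2. Differentiating in w.2 therefore only hits φ(h) and produces the factor -sin
  -- θ.
  have step : ∀ i, ∫ w, d i w.1 * φ (h (rotation (-θ) w).1) * w.2 i ∂γ.prod γ =
      ∫ w, - Real.sin θ * (d i w.1 * φ' (h (rotation (-θ) w).1) * d i (rotation (-θ) w).1)
        ∂γ.prod γ := fun i => by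
    refine integral_mul_coord_eq γ i
      (Ψ := fun w => d i w.1 * φ (h (rotation (-θ) w).1)) (fun s q t => ?_) ?_ (i1 i)
      ((i2 i).const_mul _)
    · have e1 : HasDerivAt (fun t => (rotation (-θ) (s, Function.update q i t)).1)
          (-Real.sin θ • Pi.single i (1 : ℝ)) t := by
        simp only [ContinuousLinearMap.rotation_apply, Real.cos_neg, Real.sin_neg]
        exact ((hasDerivAt_update q i t).const_smul (-Real.sin θ)).const_add _
      have e2 := (hd (rotation (-θ) (s, Function.update q i t)).1).comp_hasDerivAt t e1
      have e3 := ((hφ _).comp t e2).const_mul (d i s)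
      refine e3.congr_deriv ?_
      simp only [map_smul, sum_apply, smul_apply, Function.comp_apply,
        ContinuousLinearMap.proj_apply, Pi.single_apply, smul_eq_mul, mul_ite, mul_one, mul_zero,
        Finset.sum_ite_eq', Finset.mem_univ, if_true]
      ring
    · exact (hdf i).integrable_mul hφh
  calc ∫ z, φ (h z.1) * ∑ i, d i (rotation θ z).1 * (rotation θ z).2 i ∂γ.prod γ
      = ∫ w, φ (h (rotation (-θ) w).1) * ∑ i, d i w.1 * w.2 i ∂γ.prod γ := by
        conv_rhs => rw [← hrot.map_eq]
        rw [integral_map hrot.aemeasurable]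
        · simp only [rotation_neg_rotation]
        · have := (rotation (E := ι → ℝ) (-θ)).continuous
          exact Continuous.aestronglyMeasurable (by fun_prop)
    _ = ∑ i, ∫ w, d i w.1 * φ (h (rotation (-θ) w).1) * w.2 i ∂γ.prod γ := by
        rw [← integral_finsetSum _ fun i _ => i1 i]
        congr 1; ext w
        rw [Finset.mul_sum]
        exact Finset.sum_congr rfl fun i _ => by ring
    _ = - Real.sin θ * ∫ w, φ' (h (rotation (-θ) w).1) * ∑ i, d i (rotation (-θ) w).1 * d i w.1
          ∂γ.prod γ := by
        simp_rw [step, integral_const_mul]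
        rw [← Finset.mul_sum, ← integral_finsetSum _ fun i _ => i2 i]
        congr 2; ext w
        rw [Finset.mul_sum]
        exact Finset.sum_congr rfl fun i _ => by ring
    _ = _ := by
        congr 1
        conv_lhs => rw [← hrot.map_eq]
        rw [integral_map hrot.aemeasurable]
        · simp only [rotation_neg_rotation]
        · have := (rotation (E := ι → ℝ) (-θ)).continuous
          exact Continuous.aestronglyMeasurable (by fun_prop)

lemma memLp_two_sum_mul_coord (hd2 : ∀ i, MemLp (d i) 2 (stdGaussianPi ι)) :
    MemLp (fun w : (ι → ℝ) × (ι → ℝ) => ∑ i, d i w.1 * w.2 i) 2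
      ((stdGaussianPi ι).prod (stdGaussianPi ι)) :=
  memLp_finsetSum _ fun i _ =>
    memLp_two_mul_prod (hd2 i) (memLp_eval_stdGaussianPi i 2 (by simp))

lemma integral_deriv_rotation_eq_sub
    (hd : ∀ x, HasFDerivAt h (∑ i, d i x • ContinuousLinearMap.proj (R := ℝ) i) x)
    (hdc : ∀ i, Continuous (d i)) (z : (ι → ℝ) × (ι → ℝ)) :
    ∫ θ in (0)..(Real.pi / 2), ∑ i, d i (rotation θ z).1 * (rotation θ z).2 i = h z.2 - h z.1 := by
  rw [intervalIntegral.integral_eq_sub_of_hasDerivAt (f := fun θ => h (rotation θ z).1)]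
  · simp
  · intro θ _
    refine ((hd _).comp_hasDerivAt θ (hasDerivAt_rotation_fst z θ)).congr_deriv ?_
    simp [sum_apply]
  · simp only [ContinuousLinearMap.rotation_apply]
    exact Continuous.intervalIntegrable (by fun_prop) _ _

/-- The map (θ, z) ↦ (θ, rotation of z by θ) preserves the product measure, so both factors are
square integrable there. This is what permits exchanging the integrals over θ and z. -/
lemma integrable_prod_rotation {f : (ι → ℝ) → ℝ} {S : (ι → ℝ) × (ι → ℝ) → ℝ} (ν : Measure ℝ)
    [IsFiniteMeasure ν] (hf : MemLp f 2 (stdGaussianPi ι))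
    (hS : MemLp S 2 ((stdGaussianPi ι).prod (stdGaussianPi ι))) :
    Integrable (fun p : ℝ × ((ι → ℝ) × (ι → ℝ)) => f p.2.1 * S (rotation p.1 p.2))
      (ν.prod ((stdGaussianPi ι).prod (stdGaussianPi ι))) := by
  have h1 : MemLp (fun p : ℝ × ((ι → ℝ) × (ι → ℝ)) => S p.2) 2
      (ν.prod ((stdGaussianPi ι).prod (stdGaussianPi ι))) := hS.comp_snd ν
  have h2 := h1.comp_measurePreserving
      (measurePreserving_prod_rotation (integral_id_stdGaussianPi (ι := ι)) ν)
  have h3 : MemLp (fun z : (ι → ℝ) × (ι → ℝ) => f z.1) 2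
      ((stdGaussianPi ι).prod (stdGaussianPi ι)) := hf.comp_fst _
  have h4 : MemLp (fun p : ℝ × ((ι → ℝ) × (ι → ℝ)) => f p.2.1) 2
      (ν.prod ((stdGaussianPi ι).prod (stdGaussianPi ι))) := h3.comp_snd ν
  exact h4.integrable_mul h2

/-- **Covariance identity** for the gaussian measure: the covariance of `φ(h)` and `h` as an
integral over the rotations of a pair of independent gaussian vectors. -/
theorem covariance_eq_integral_rotation
    (hd : ∀ x, HasFDerivAt h (∑ i, d i x • ContinuousLinearMap.proj (R := ℝ) i) x)
    (hdc : ∀ i, Continuous (d i))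
    (hh2 : MemLp h 2 (stdGaussianPi ι)) (hd2 : ∀ i, MemLp (d i) 2 (stdGaussianPi ι))
    (hφ : ∀ t, HasDerivAt φ (φ' t) t) (hφc : Continuous φ') (hC : ∀ t, |φ' t| ≤ C) :
    IntervalIntegrable (fun θ => Real.sin θ *
        ∫ z, φ' (h z.1) * ∑ i, d i z.1 * d i (rotation θ z).1
          ∂(stdGaussianPi ι).prod (stdGaussianPi ι)) volume 0 (Real.pi / 2) ∧
      ∫ x, φ (h x) * h x ∂stdGaussianPi ι
        - (∫ x, φ (h x) ∂stdGaussianPi ι) * ∫ x, h x ∂stdGaussianPi ι =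
      ∫ θ in (0)..(Real.pi / 2), Real.sin θ *
        ∫ z, φ' (h z.1) * ∑ i, d i z.1 * d i (rotation θ z).1
          ∂(stdGaussianPi ι).prod (stdGaussianPi ι) := by
  set γ := stdGaussianPi ι with hγ
  have hpi : (0 : ℝ) ≤ Real.pi / 2 := by positivity
  have hhc : Continuous h := continuous_iff_continuousAt.2 fun x => (hd x).continuousAt
  have hφ2 := memLp_two_comp_of_deriv_le hh2 hφ hC
  set ν : Measure ℝ := volume.restrict (Set.Ioc 0 (Real.pi / 2)) with hν
  have hint : Integrable (fun p : ℝ × ((ι → ℝ) × (ι → ℝ)) => φ (h p.2.1) *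
      ∑ i, d i (rotation p.1 p.2).1 * (rotation p.1 p.2).2 i) (ν.prod (γ.prod γ)) :=
    integrable_prod_rotation ν hφ2 (memLp_two_sum_mul_coord hd2)
  have key : ∀ θ, ∫ z, φ (h z.1) * ∑ i, d i (rotation θ z).1 * (rotation θ z).2 i ∂γ.prod γ =
      -(Real.sin θ * ∫ z, φ' (h z.1) * ∑ i, d i z.1 * d i (rotation θ z).1 ∂γ.prod γ) := fun θ => by
    rw [integral_mul_rotation_eq hd hdc hh2 hd2 hφ hφc hC θ]; ring
  constructor
  · rw [intervalIntegrable_iff_integrableOn_Ioc_of_le hpi]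
    have := hint.integral_prod_left.neg
    exact this.congr (ae_of_all _ fun θ => by simp only [Pi.neg_apply, key, neg_neg])
  · have ftc : ∀ z : (ι → ℝ) × (ι → ℝ),
        ∫ θ, ∑ i, d i (rotation θ z).1 * (rotation θ z).2 i ∂ν = h z.2 - h z.1 := fun z => by
      rw [hν, ← intervalIntegral.integral_of_le hpi, integral_deriv_rotation_eq_sub hd hdc]
    -- Independence of the two copies turns this into minus the covariance.
    have h1 : ∫ z, φ (h z.1) * (h z.2 - h z.1) ∂γ.prod γ =
        (∫ x, φ (h x) ∂γ) * (∫ x, h x ∂γ) - ∫ x, φ (h x) * h x ∂γ := by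
      have a1 : Integrable (fun z : (ι → ℝ) × (ι → ℝ) => φ (h z.1) * h z.2) (γ.prod γ) :=
        (hφ2.integrable one_le_two).mul_prod (hh2.integrable one_le_two)
      have a2 : Integrable (fun z : (ι → ℝ) × (ι → ℝ) => φ (h z.1) * h z.1) (γ.prod γ) :=
        (hφ2.integrable_mul hh2).comp_fst γ
      simp only [mul_sub]
      rw [integral_sub a1 a2, integral_prod_mul (fun x => φ (h x)) h]
      congr 1
      have := integral_fun_fst (μ := γ) (ν := γ) (f := fun x => φ (h x) * h x)
      simpa using this
    have h2 : ∫ z, φ (h z.1) * (h z.2 - h z.1) ∂γ.prod γ =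
        ∫ θ, ∫ z, φ (h z.1) * ∑ i, d i (rotation θ z).1 * (rotation θ z).2 i ∂γ.prod γ ∂ν := by
      rw [integral_integral_swap hint]
      congr 1; ext z
      rw [integral_const_mul, ftc]
    rw [intervalIntegral.integral_of_le hpi, ← hν]
    simp only [key] at h2
    rw [integral_neg, h1] at h2
    linarith

end Covariance

/-! ### The L¹ Poincaré inequality and the Stein-type bound -/

section PoincareL1

open ContinuousLinearMap (rotation)

lemma integral_comp_of_measurePreserving {α β : Type*} [MeasurableSpace α] [MeasurableSpace β]
    {μ : Measure α} {ν : Measure β} {f : α → β} (hf : MeasurePreserving f μ ν) {g : β → ℝ}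
    (hg : AEStronglyMeasurable g ν) : ∫ x, g (f x) ∂μ = ∫ y, g y ∂ν := by
  rw [← hf.map_eq] at hg ⊢
  exact (integral_map hf.aemeasurable hg).symm

section General

variable {F : Type*} [NormedAddCommGroup F] [NormedSpace ℝ F] [SecondCountableTopology F]
  [CompleteSpace F] [MeasurableSpace F] [BorelSpace F] {μ : Measure F} [IsGaussian μ]

/-- An `L¹` Poincaré inequality for centered gaussian measures, for the difference of two
independent copies. -/
lemma lintegral_enorm_sub_le (hμ : μ[id] = 0) {G : F → ℝ} (hG : ContDiff ℝ 1 G) :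
    ∫⁻ z, ‖G z.2 - G z.1‖ₑ ∂μ.prod μ ≤
      ENNReal.ofReal (Real.pi / 2) * ∫⁻ z, ‖fderiv ℝ G z.1 z.2‖ₑ ∂μ.prod μ := by
  have hpi : (0 : ℝ) ≤ Real.pi / 2 := by positivity
  have hDc : Continuous fun z : F × F => fderiv ℝ G z.1 z.2 :=
    ((hG.continuous_fderiv one_ne_zero).comp continuous_fst).clm_apply continuous_snd
  have hD : Measurable fun z : F × F => ‖fderiv ℝ G z.1 z.2‖ₑ := hDc.measurable.enorm
  have hrc : ∀ z : F × F, Continuous fun θ => rotation θ z := fun z => by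
    simp only [ContinuousLinearMap.rotation_apply]; fun_prop
  have pt : ∀ z : F × F, ‖G z.2 - G z.1‖ₑ ≤
      ∫⁻ θ in Set.Ioc 0 (Real.pi / 2), ‖fderiv ℝ G (rotation θ z).1 (rotation θ z).2‖ₑ := fun z => by
    have ftc : ∫ θ in (0)..(Real.pi / 2), fderiv ℝ G (rotation θ z).1 (rotation θ z).2 =
        G z.2 - G z.1 := by
      rw [intervalIntegral.integral_eq_sub_of_hasDerivAt (f := fun θ => G (rotation θ z).1)]
      · simp
      · intro θ _
        exact ((hG.differentiable one_ne_zero _).hasFDerivAt).comp_hasDerivAt θ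
          (hasDerivAt_rotation_fst z θ)
      · exact (hDc.comp (hrc z)).intervalIntegrable _ _
    rw [← ftc, intervalIntegral.integral_of_le hpi]
    exact enorm_integral_le_lintegral_enorm _
  calc ∫⁻ z, ‖G z.2 - G z.1‖ₑ ∂μ.prod μ
      ≤ ∫⁻ z, (∫⁻ θ in Set.Ioc 0 (Real.pi / 2),
          ‖fderiv ℝ G (rotation θ z).1 (rotation θ z).2‖ₑ) ∂μ.prod μ := lintegral_mono pt
    _ = ∫⁻ θ in Set.Ioc 0 (Real.pi / 2), (∫⁻ z,
          ‖fderiv ℝ G (rotation θ z).1 (rotation θ z).2‖ₑ ∂μ.prod μ) := by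
        rw [lintegral_lintegral_swap]
        have hc : Continuous fun p : (F × F) × ℝ => rotation p.2 p.1 := by
          simp only [ContinuousLinearMap.rotation_apply]; fun_prop
        have := hDc.comp hc
        exact this.measurable.enorm.aemeasurable
    _ = ∫⁻ _ in Set.Ioc 0 (Real.pi / 2), ∫⁻ z, ‖fderiv ℝ G z.1 z.2‖ₑ ∂μ.prod μ := by
        congr 1; ext θ
        exact (measurePreserving_rotation hμ θ).lintegral_comp hD
    _ = _ := by
        rw [lintegral_const, mul_comm]
        simp [Real.volume_Ioc]

/-- An `L¹` Poincaré inequality for centered gaussian measures. -/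
lemma lintegral_enorm_sub_integral_le (hμ : μ[id] = 0) {G : F → ℝ} (hG : ContDiff ℝ 1 G)
    (hGi : Integrable G μ) :
    ∫⁻ z, ‖G z - ∫ w, G w ∂μ‖ₑ ∂μ ≤
      ENNReal.ofReal (Real.pi / 2) * ∫⁻ z, ∫⁻ w, ‖fderiv ℝ G z w‖ₑ ∂μ ∂μ := by
  have hDc : Continuous fun z : F × F => fderiv ℝ G z.1 z.2 :=
    ((hG.continuous_fderiv one_ne_zero).comp continuous_fst).clm_apply continuous_snd
  rw [← lintegral_prod (fun z : F × F => ‖fderiv ℝ G z.1 z.2‖ₑ)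
    hDc.measurable.enorm.aemeasurable]
  refine le_trans ?_ (lintegral_enorm_sub_le hμ hG)
  have hGm := hG.continuous.measurable
  rw [lintegral_prod _ (by fun_prop)]
  refine lintegral_mono fun z => ?_
  have : G z - ∫ w, G w ∂μ = ∫ w, (G z - G w) ∂μ := by
    rw [integral_sub (integrable_const _) hGi]; simp
  rw [this]
  refine (enorm_integral_le_lintegral_enorm _).trans (le_of_eq ?_)
  congr 1; ext w
  exact enorm_sub_rev _ _

end General

variable {ι : Type*} [Fintype ι]

/-- The L¹ norm is at most the L² norm, and the second moment of a linear form comes from the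
covariance identity with φ = id: the gradient is constant and sin integrates to 1 over [0, π/2]. -/
lemma lintegral_enorm_sum_mul_coord_le (l : ι → ℝ) :
    ∫⁻ x : ι → ℝ, ‖∑ i, l i * x i‖ₑ ∂stdGaussianPi ι ≤ ENNReal.ofReal √(∑ i, l i ^ 2) := by
  set γ := stdGaussianPi ι with hγ
  set h : (ι → ℝ) → ℝ := fun x => ∑ i, l i * x i with hh
  have hh2 : MemLp h 2 γ := memLp_finsetSum _ fun i _ =>
    (memLp_eval_stdGaussianPi i 2 (by simp)).const_mul (l i)
  have hd : ∀ x, HasFDerivAt h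
      (∑ i, (fun _ : ι → ℝ => l i) x • ContinuousLinearMap.proj (R := ℝ) i) x := fun x => by
    have : h = ⇑(∑ i, l i • ContinuousLinearMap.proj (R := ℝ) (φ := fun _ : ι => ℝ) i) := by
      ext x; simp [hh, sum_apply]
    rw [this]
    exact ContinuousLinearMap.hasFDerivAt _
  have hcov := (covariance_eq_integral_rotation (φ := id) (φ' := fun _ => 1) (C := 1) hd
    (fun i => continuous_const) hh2 (fun i => memLp_const _) (fun t => hasDerivAt_id t)
    continuous_const (by simp)).2
  have hsq : ∫ x, h x ^ 2 ∂γ = ∑ i, l i ^ 2 := by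
    have hzero : ∫ x, h x ∂γ = 0 := by
      rw [hh, integral_finsetSum]
      · refine Finset.sum_eq_zero fun i _ => ?_
        have h3 := integral_map (μ := stdGaussianPi ι) (φ := fun x : ι → ℝ => x i)
          (f := fun t : ℝ => t) (measurable_pi_apply i).aemeasurable (by fun_prop)
        rw [(measurePreserving_eval_stdGaussianPi i).map_eq, integral_id_gaussianReal] at h3
        rw [integral_const_mul, hγ, ← h3, mul_zero]
      · intro i _
        exact ((memLp_eval_stdGaussianPi i 1 (by simp)).integrable le_rfl).const_mul _
    have e : ∀ x, id (h x) * h x = h x ^ 2 := fun x => by simp [sq]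
    simp only [e] at hcov
    rw [← hγ, hzero] at hcov
    rw [mul_zero, sub_zero] at hcov
    rw [hcov]
    simp [integral_sin, sq]
  calc ∫⁻ x, ‖h x‖ₑ ∂γ = eLpNorm h 1 γ := eLpNorm_one_eq_lintegral_enorm.symm
    _ ≤ eLpNorm h 2 γ := eLpNorm_le_eLpNorm_of_exponent_le one_le_two hh2.aestronglyMeasurable
    _ = ENNReal.ofReal √(∑ i, l i ^ 2) := by
        rw [hh2.eLpNorm_eq_integral_rpow_norm (by simp) (by simp), ← hsq, Real.sqrt_eq_rpow]
        simp

variable {h : (ι → ℝ) → ℝ} {d : ι → (ι → ℝ) → ℝ} {φ φ' : ℝ → ℝ} {C : ℝ}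

section Pair

/-- The first marginal and a rotation of the pair, as a linear map. -/
def fstRotation (ι : Type*) [Fintype ι] (θ : ℝ) :
    ((ι → ℝ) × (ι → ℝ)) →L[ℝ] ((ι → ℝ) × (ι → ℝ)) :=
  (ContinuousLinearMap.fst ℝ _ _).prod ((ContinuousLinearMap.fst ℝ _ _).comp (rotation θ))

/-- The law of `(X, X_θ)`. -/
def rotationLaw (ι : Type*) [Fintype ι] (θ : ℝ) : Measure ((ι → ℝ) × (ι → ℝ)) :=
  ((stdGaussianPi ι).prod (stdGaussianPi ι)).map (fstRotation ι θ)

/-- A linear image of a gaussian measure. It is correlated, and degenerate at θ = 0, which is why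
the Poincaré inequality above is stated for arbitrary centred gaussian measures. -/
instance (θ : ℝ) : IsGaussian (rotationLaw ι θ) := by unfold rotationLaw; infer_instance

lemma measurePreserving_fstRotation (θ : ℝ) :
    MeasurePreserving (fstRotation ι θ) ((stdGaussianPi ι).prod (stdGaussianPi ι))
      (rotationLaw ι θ) :=
  ⟨(fstRotation ι θ).continuous.measurable, rfl⟩

lemma measurePreserving_fst_rotationLaw (θ : ℝ) :
    MeasurePreserving Prod.fst (rotationLaw ι θ) (stdGaussianPi ι) := by
  refine ⟨measurable_fst, ?_⟩
  rw [rotationLaw, Measure.map_map measurable_fst (fstRotation ι θ).continuous.measurable]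
  exact measurePreserving_fst.map_eq

lemma measurePreserving_snd_rotationLaw (θ : ℝ) :
    MeasurePreserving Prod.snd (rotationLaw ι θ) (stdGaussianPi ι) := by
  refine ⟨measurable_snd, ?_⟩
  rw [rotationLaw, Measure.map_map measurable_snd (fstRotation ι θ).continuous.measurable]
  exact (measurePreserving_fst.comp (measurePreserving_rotation_stdGaussianPi θ)).map_eq

lemma integral_id_rotationLaw (θ : ℝ) : (rotationLaw ι θ)[id] = 0 := by
  have hi : Integrable (id : (ι → ℝ) × (ι → ℝ) → _) (rotationLaw ι θ) := IsGaussian.integrable_id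
  have hfi : Integrable (fun z : (ι → ℝ) × (ι → ℝ) => z.1) (rotationLaw ι θ) := hi.fst
  have hsi : Integrable (fun z : (ι → ℝ) × (ι → ℝ) => z.2) (rotationLaw ι θ) := hi.snd
  have e1 : ∫ z, z.1 ∂rotationLaw ι θ = 0 := by
    have := integral_map (μ := rotationLaw ι θ) (f := fun x : ι → ℝ => x)
      measurable_fst.aemeasurable aestronglyMeasurable_id
    rw [(measurePreserving_fst_rotationLaw θ).map_eq] at this
    rw [← this]; exact integral_id_stdGaussianPi
  have e2 : ∫ z, z.2 ∂rotationLaw ι θ = 0 := by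
    have := integral_map (μ := rotationLaw ι θ) (f := fun x : ι → ℝ => x)
      measurable_snd.aemeasurable aestronglyMeasurable_id
    rw [(measurePreserving_snd_rotationLaw θ).map_eq] at this
    rw [← this]; exact integral_id_stdGaussianPi
  have := integral_pair hfi hsi
  rw [e1, e2] at this
  exact this

lemma integrable_sum_mul_rotationLaw (hd2 : ∀ i, MemLp (d i) 2 (stdGaussianPi ι)) (θ : ℝ) :
    Integrable (fun z : (ι → ℝ) × (ι → ℝ) => ∑ i, d i z.1 * d i z.2) (rotationLaw ι θ) :=
  integrable_finsetSum _ fun i _ =>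
    ((hd2 i).comp_measurePreserving (measurePreserving_fst_rotationLaw θ)).integrable_mul
      ((hd2 i).comp_measurePreserving (measurePreserving_snd_rotationLaw θ))

variable [DecidableEq ι]

/-- The euclidean norm of the linear form `x' ↦ ⟨D(∇h)(x) x', ∇h(y)⟩`, where `d` is the gradient
of `h`. -/
def hessGradNorm (d : ι → (ι → ℝ) → ℝ) (z : (ι → ℝ) × (ι → ℝ)) : ℝ :=
  √(∑ k, (∑ i, fderiv ℝ (d i) z.1 (Pi.single k 1) * d i z.2) ^ 2)

/-- The product rule splits the derivative into a linear form in w.1 and one in w.2. After the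
triangle inequality only the marginals of ρ matter, so the correlation between the two halves plays
no role. -/
lemma lintegral_enorm_fderiv_le (hdc : ∀ i, ContDiff ℝ 1 (d i))
    {ρ : Measure ((ι → ℝ) × (ι → ℝ))}
    (h1 : MeasurePreserving Prod.fst ρ (stdGaussianPi ι))
    (h2 : MeasurePreserving Prod.snd ρ (stdGaussianPi ι)) (z : (ι → ℝ) × (ι → ℝ)) :
    ∫⁻ w, ‖fderiv ℝ (fun z : (ι → ℝ) × (ι → ℝ) => ∑ i, d i z.1 * d i z.2) z w‖ₑ ∂ρ ≤
      ENNReal.ofReal (hessGradNorm d z) + ENNReal.ofReal (hessGradNorm d z.swap) := by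
  have hdd : ∀ i x, HasFDerivAt (d i) (fderiv ℝ (d i) x) x := fun i x =>
    ((hdc i).differentiable one_ne_zero x).hasFDerivAt
  have hlin : ∀ (i : ι) (x v : ι → ℝ),
      fderiv ℝ (d i) x v = ∑ k, fderiv ℝ (d i) x (Pi.single k 1) * v k := fun i x v => by
    conv_lhs => rw [pi_eq_sum_univ' v]
    simp [map_sum, mul_comm]
  have hD : ∀ w : (ι → ℝ) × (ι → ℝ),
      fderiv ℝ (fun z : (ι → ℝ) × (ι → ℝ) => ∑ i, d i z.1 * d i z.2) z w =
      ∑ k, (∑ i, fderiv ℝ (d i) z.1 (Pi.single k 1) * d i z.2) * w.1 k +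
      ∑ k, (∑ i, fderiv ℝ (d i) z.2 (Pi.single k 1) * d i z.1) * w.2 k := fun w => by
    have : HasFDerivAt (fun z : (ι → ℝ) × (ι → ℝ) => ∑ i, d i z.1 * d i z.2)
        (∑ i, (d i z.1 • (fderiv ℝ (d i) z.2).comp (ContinuousLinearMap.snd ℝ _ _) +
          d i z.2 • (fderiv ℝ (d i) z.1).comp (ContinuousLinearMap.fst ℝ _ _))) z :=
      HasFDerivAt.fun_sum fun i _ =>
        ((hdd i z.1).comp z hasFDerivAt_fst).mul ((hdd i z.2).comp z hasFDerivAt_snd)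
    rw [this.fderiv]
    simp only [sum_apply, add_apply, smul_apply, ContinuousLinearMap.comp_apply,
      ContinuousLinearMap.coe_fst', ContinuousLinearMap.coe_snd', smul_eq_mul]
    rw [Finset.sum_add_distrib, add_comm]
    congr 1
    · simp_rw [hlin _ _ w.1, Finset.mul_sum, Finset.sum_mul]
      rw [Finset.sum_comm]
      exact Finset.sum_congr rfl fun _ _ => Finset.sum_congr rfl fun _ _ => by ring
    · simp_rw [hlin _ _ w.2, Finset.mul_sum, Finset.sum_mul]
      rw [Finset.sum_comm]
      exact Finset.sum_congr rfl fun _ _ => Finset.sum_congr rfl fun _ _ => by ring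
  have hm : ∀ l : ι → ℝ, Measurable fun x : ι → ℝ => ‖∑ i, l i * x i‖ₑ := fun l => by fun_prop
  simp_rw [hD]
  calc _ ≤ ∫⁻ w, (‖∑ k, (∑ i, fderiv ℝ (d i) z.1 (Pi.single k 1) * d i z.2) * w.1 k‖ₑ +
      ‖∑ k, (∑ i, fderiv ℝ (d i) z.2 (Pi.single k 1) * d i z.1) * w.2 k‖ₑ) ∂ρ :=
        lintegral_mono fun w => enorm_add_le _ _
    _ = ∫⁻ w, ‖∑ k, (∑ i, fderiv ℝ (d i) z.1 (Pi.single k 1) * d i z.2) * w.1 k‖ₑ ∂ρ +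
      ∫⁻ w, ‖∑ k, (∑ i, fderiv ℝ (d i) z.2 (Pi.single k 1) * d i z.1) * w.2 k‖ₑ ∂ρ :=
        lintegral_add_left ((hm _).comp measurable_fst) _
    _ ≤ _ := by
        refine add_le_add ?_ ?_
        · exact (h1.lintegral_comp (hm _)).trans_le (lintegral_enorm_sum_mul_coord_le _)
        · exact (h2.lintegral_comp (hm _)).trans_le (lintegral_enorm_sum_mul_coord_le _)

/-- The fluctuation of `⟨∇h(X), ∇h(X_θ)⟩` in `L¹`. -/
lemma lintegral_enorm_sub_rotationLaw_le (hdc : ∀ i, ContDiff ℝ 1 (d i))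
    (hd2 : ∀ i, MemLp (d i) 2 (stdGaussianPi ι)) {K : ℝ≥0∞}
    (hK : ∀ ρ : Measure ((ι → ℝ) × (ι → ℝ)), MeasurePreserving Prod.fst ρ (stdGaussianPi ι) →
      MeasurePreserving Prod.snd ρ (stdGaussianPi ι) →
      ∫⁻ z, ENNReal.ofReal (hessGradNorm d z) ∂ρ ≤ K) (θ : ℝ) :
    ∫⁻ z, ‖(∑ i, d i z.1 * d i z.2) - ∫ w, ∑ i, d i w.1 * d i w.2 ∂rotationLaw ι θ‖ₑ
      ∂rotationLaw ι θ ≤ ENNReal.ofReal Real.pi * K := by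
  have hf := measurePreserving_fst_rotationLaw (ι := ι) θ
  have hs := measurePreserving_snd_rotationLaw (ι := ι) θ
  have hG : ContDiff ℝ 1 fun z : (ι → ℝ) × (ι → ℝ) => ∑ i, d i z.1 * d i z.2 :=
    ContDiff.sum fun i _ => ((hdc i).comp contDiff_fst).mul ((hdc i).comp contDiff_snd)
  have hQm : Measurable fun z : (ι → ℝ) × (ι → ℝ) => ENNReal.ofReal (hessGradNorm d z) := by
    have hc : ∀ i k, Continuous fun x => fderiv ℝ (d i) x (Pi.single k 1) := fun i k =>
      ((hdc i).continuous_fderiv one_ne_zero).clm_apply continuous_const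
    have hc' : ∀ i, Continuous (d i) := fun i => (hdc i).continuous
    have : Continuous (hessGradNorm d) := by unfold hessGradNorm; fun_prop
    exact this.measurable.ennreal_ofReal
  refine (lintegral_enorm_sub_integral_le (integral_id_rotationLaw θ) hG
    (integrable_sum_mul_rotationLaw hd2 θ)).trans ?_
  calc _ ≤ ENNReal.ofReal (Real.pi / 2) * ∫⁻ z, (ENNReal.ofReal (hessGradNorm d z) +
        ENNReal.ofReal (hessGradNorm d z.swap)) ∂rotationLaw ι θ := by
        gcongr with z
        exact lintegral_enorm_fderiv_le hdc hf hs z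
    _ ≤ ENNReal.ofReal (Real.pi / 2) * (K + K) := by
        rw [lintegral_add_left hQm]
        gcongr
        · exact hK _ hf hs
        · have hsw : MeasurePreserving Prod.swap (rotationLaw ι θ)
              ((rotationLaw ι θ).map Prod.swap) := ⟨measurable_swap, rfl⟩
          rw [hsw.lintegral_comp hQm]
          -- The second half of the gradient is the first one under the swapped coupling, to which
          -- `hK` applies because it covers all couplings with these marginals.
          refine hK _ ⟨measurable_fst, ?_⟩ ⟨measurable_snd, ?_⟩
          · rw [Measure.map_map measurable_fst measurable_swap]; exact hs.map_eq
          · rw [Measure.map_map measurable_snd measurable_swap]; exact hf.map_eq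
    _ = _ := by
        rw [← two_mul, ← mul_assoc]
        congr 1
        rw [← ENNReal.ofReal_ofNat, ← ENNReal.ofReal_mul (by positivity)]
        congr 1; ring

/-- The Stein-type bound for a function `h` of a standard gaussian vector, with `W = h(X)`:
`|σ² E φ'(W) - Cov(φ(W), W)| ≤ π K sup|φ'|`. -/
theorem abs_variance_mul_sub_covariance_le
    (hd : ∀ x, HasFDerivAt h (∑ i, d i x • ContinuousLinearMap.proj (R := ℝ) i) x)
    (hdc : ∀ i, ContDiff ℝ 1 (d i))
    (hh2 : MemLp h 2 (stdGaussianPi ι)) (hd2 : ∀ i, MemLp (d i) 2 (stdGaussianPi ι))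
    (hφ : ∀ t, HasDerivAt φ (φ' t) t) (hφc : Continuous φ') (hC : ∀ t, |φ' t| ≤ C)
    {K : ℝ≥0∞} (hKtop : K ≠ ∞)
    (hK : ∀ ρ : Measure ((ι → ℝ) × (ι → ℝ)), MeasurePreserving Prod.fst ρ (stdGaussianPi ι) →
      MeasurePreserving Prod.snd ρ (stdGaussianPi ι) →
      ∫⁻ z, ENNReal.ofReal (hessGradNorm d z) ∂ρ ≤ K) :
    |variance h (stdGaussianPi ι) * ∫ x, φ' (h x) ∂stdGaussianPi ι -
      (∫ x, φ (h x) * h x ∂stdGaussianPi ι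
        - (∫ x, φ (h x) ∂stdGaussianPi ι) * ∫ x, h x ∂stdGaussianPi ι)| ≤
      C * (Real.pi * K.toReal) := by
  set γ := stdGaussianPi ι with hγ
  have hpi : (0 : ℝ) ≤ Real.pi / 2 := by positivity
  have hC0 : 0 ≤ C := (abs_nonneg _).trans (hC 0)
  have hhc : Continuous h := continuous_iff_continuousAt.2 fun x => (hd x).continuousAt
  have hdc0 : ∀ i, Continuous (d i) := fun i => (hdc i).continuous
  set Γ : (ι → ℝ) × (ι → ℝ) → ℝ := fun z => ∑ i, d i z.1 * d i z.2 with hΓ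
  obtain ⟨c1, c2⟩ := covariance_eq_integral_rotation hd hdc0 hh2 hd2 hφ hφc hC
  obtain ⟨v1, v2⟩ := covariance_eq_integral_rotation (φ := id) (φ' := fun _ => 1) (C := 1) hd
    hdc0 hh2 hd2 (fun t => hasDerivAt_id t) continuous_const (by simp)
  have hvar : variance h γ = ∫ x, id (h x) * h x ∂γ - (∫ x, id (h x) ∂γ) * ∫ x, h x ∂γ := by
    rw [variance_eq_sub hh2]
    simp [sq]
  rw [hvar, v2, c2, mul_comm, ← intervalIntegral.integral_const_mul,
    ← intervalIntegral.integral_sub (v1.const_mul _) c1]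
  have hmp := measurePreserving_fstRotation (ι := ι)
  have hΓi := integrable_sum_mul_rotationLaw hd2
  have hΓc : Continuous Γ := by fun_prop
  have bound : ∀ θ, |(∫ x, φ' (h x) ∂γ) * (Real.sin θ * ∫ z, 1 * ∑ i, d i z.1 *
      d i (rotation θ z).1 ∂γ.prod γ) - Real.sin θ *
      ∫ z, φ' (h z.1) * ∑ i, d i z.1 * d i (rotation θ z).1 ∂γ.prod γ| ≤
      |Real.sin θ| * (C * (Real.pi * K.toReal)) := fun θ => by
    set m := ∫ w, Γ w ∂rotationLaw ι θ with hm
    have hm' : ∫ z, 1 * ∑ i, d i z.1 * d i (rotation θ z).1 ∂γ.prod γ = m := by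
      simp only [one_mul]
      exact integral_comp_of_measurePreserving (hmp θ) (g := Γ) hΓc.aestronglyMeasurable
    have hfl : ∫ z, |Γ z - m| ∂rotationLaw ι θ ≤ Real.pi * K.toReal := by
      have h1 := lintegral_enorm_sub_rotationLaw_le hdc hd2 hK θ
      have h2 : ∫ z, |Γ z - m| ∂rotationLaw ι θ =
          (∫⁻ z, ‖Γ z - m‖ₑ ∂rotationLaw ι θ).toReal :=
        integral_norm_eq_lintegral_enorm (hΓc.sub continuous_const).aestronglyMeasurable
      rw [h2]
      refine (ENNReal.toReal_mono (ENNReal.mul_ne_top ENNReal.ofReal_ne_top hKtop) h1).trans ?_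
      rw [ENNReal.toReal_mul, ENNReal.toReal_ofReal Real.pi_pos.le]
    have e1 : ∫ x, φ' (h x) ∂γ = ∫ z, φ' (h z.1) ∂rotationLaw ι θ :=
      (integral_comp_of_measurePreserving (measurePreserving_fst_rotationLaw θ)
        (g := fun x => φ' (h x)) (hφc.comp hhc).aestronglyMeasurable).symm
    have e2 : ∫ z, φ' (h z.1) * ∑ i, d i z.1 * d i (rotation θ z).1 ∂γ.prod γ =
        ∫ z, φ' (h z.1) * Γ z ∂rotationLaw ι θ :=
      integral_comp_of_measurePreserving (hmp θ) (g := fun z => φ' (h z.1) * Γ z)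
        ((hφc.comp (hhc.comp continuous_fst)).mul hΓc).aestronglyMeasurable
    have hφm : AEStronglyMeasurable (fun z : (ι → ℝ) × (ι → ℝ) => φ' (h z.1)) (rotationLaw ι θ) :=
      (hφc.comp (hhc.comp continuous_fst)).aestronglyMeasurable
    have i1 : Integrable (fun z : (ι → ℝ) × (ι → ℝ) => φ' (h z.1)) (rotationLaw ι θ) :=
      Integrable.of_bound hφm C (ae_of_all _ fun z => hC _)
    have i2 : Integrable (fun z : (ι → ℝ) × (ι → ℝ) => φ' (h z.1) * Γ z) (rotationLaw ι θ) :=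
      (hΓi θ).bdd_mul (c := C) hφm (ae_of_all _ fun z => hC _)
    have i3 : Integrable (fun z => C * |Γ z - m|) (rotationLaw ι θ) :=
      (((hΓi θ).sub (integrable_const m)).abs).const_mul C
    rw [hm', e2, e1]
    -- Because m is the mean of Γ, the difference of the two covariance integrands is the integral
    -- of φ' against m - Γ.
    have e3 : (∫ z, φ' (h z.1) ∂rotationLaw ι θ) * (Real.sin θ * m) -
        Real.sin θ * ∫ z, φ' (h z.1) * Γ z ∂rotationLaw ι θ =
        Real.sin θ * ∫ z, (φ' (h z.1) * m - φ' (h z.1) * Γ z) ∂rotationLaw ι θ := by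
      rw [integral_sub (i1.mul_const m) i2, integral_mul_const]; ring
    rw [e3, abs_mul]
    gcongr
    calc |∫ z, (φ' (h z.1) * m - φ' (h z.1) * Γ z) ∂rotationLaw ι θ|
        ≤ ∫ z, C * |Γ z - m| ∂rotationLaw ι θ := by
          rw [← Real.norm_eq_abs]
          refine norm_integral_le_of_norm_le i3 (ae_of_all _ fun z => ?_)
          rw [← mul_sub, norm_mul, Real.norm_eq_abs, Real.norm_eq_abs, abs_sub_comm m]
          gcongr
          exact hC _
      _ ≤ C * (Real.pi * K.toReal) := by
          rw [integral_const_mul]; gcongr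
  rw [← Real.norm_eq_abs]
  calc _ ≤ ∫ θ in (0)..(Real.pi / 2), Real.sin θ * (C * (Real.pi * K.toReal)) := by
        refine intervalIntegral.norm_integral_le_of_norm_le hpi (ae_of_all _ fun θ hθ => ?_)
          (Continuous.intervalIntegrable (by fun_prop) _ _)
        have hs : 0 ≤ Real.sin θ :=
          Real.sin_nonneg_of_nonneg_of_le_pi hθ.1.le (by linarith [hθ.2, Real.pi_pos])
        have := bound θ
        rwa [abs_of_nonneg hs] at this
    _ = _ := by
        rw [intervalIntegral.integral_mul_const, integral_sin]; simp

end Pair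

end PoincareL1

/-! ### Stein's equation and total variation distance -/

section Stein

open Filter Topology

lemma tendsto_gaussianPDFReal_atTop : Tendsto (gaussianPDFReal 0 1) atTop (𝓝 0) := by
  have h : gaussianPDFReal 0 1 = fun x => (√(2 * Real.pi))⁻¹ * Real.exp (-x ^ 2 / 2) := by
    ext x; simp [gaussianPDFReal]
  rw [h, ← mul_zero (√(2 * Real.pi))⁻¹]
  refine Tendsto.const_mul _ (Real.tendsto_exp_atBot.comp ?_)
  have : Tendsto (fun x : ℝ => x ^ 2 / 2) atTop atTop :=
    (tendsto_pow_atTop two_ne_zero).atTop_div_const two_pos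
  refine (tendsto_neg_atTop_atBot.comp this).congr fun x => ?_
  simp only [Function.comp_apply]; ring

lemma gaussianPDFReal_neg_arg (x : ℝ) : gaussianPDFReal 0 1 (-x) = gaussianPDFReal 0 1 x := by
  simp [gaussianPDFReal]

/-- The Mills ratio bound for the gaussian tail. -/
lemma mul_integral_Ioi_gaussianPDFReal_le {x : ℝ} (hx : 0 ≤ x) :
    x * ∫ t in Set.Ioi x, gaussianPDFReal 0 1 t ≤ gaussianPDFReal 0 1 x := by
  have hder : ∀ t ∈ Set.Ici x, HasDerivAt (fun t => -gaussianPDFReal 0 1 t)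
      (t * gaussianPDFReal 0 1 t) t := fun t _ =>
    (hasDerivAt_gaussianPDFReal t).fun_neg.congr_deriv (by ring)
  have hpos : ∀ t ∈ Set.Ioi x, 0 ≤ t * gaussianPDFReal 0 1 t := fun t ht =>
    mul_nonneg (hx.trans (le_of_lt ht)) (gaussianPDFReal_nonneg _ _ _)
  have hlim : Tendsto (fun t => -gaussianPDFReal 0 1 t) atTop (𝓝 (-0)) :=
    tendsto_gaussianPDFReal_atTop.neg
  have hi := integrableOn_Ioi_deriv_of_nonneg' hder hpos hlim
  have he := integral_Ioi_of_hasDerivAt_of_nonneg' hder hpos hlim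
  rw [← integral_const_mul]
  calc ∫ t in Set.Ioi x, x * gaussianPDFReal 0 1 t
      ≤ ∫ t in Set.Ioi x, t * gaussianPDFReal 0 1 t := by
        refine setIntegral_mono_on ((integrable_gaussianPDFReal 0 1).integrableOn.const_mul x) hi
          measurableSet_Ioi fun t ht => ?_
        exact mul_le_mul_of_nonneg_right (le_of_lt ht) (gaussianPDFReal_nonneg _ _ _)
    _ = _ := by rw [he]; ring

/-- The solution of Stein's equation for a continuous test function with values in `[0, 1]`. -/
lemma exists_stein_solution {k : ℝ → ℝ} (hk : Continuous k) (h0 : ∀ x, 0 ≤ k x)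
    (h1 : ∀ x, k x ≤ 1) :
    ∃ φ φ' : ℝ → ℝ, (∀ t, HasDerivAt φ (φ' t) t) ∧ Continuous φ' ∧ (∀ t, |φ' t| ≤ 2) ∧
      ∀ t, φ' t - t * φ t = k t - ∫ s, k s ∂gaussianReal 0 1 := by
  set ρ := gaussianPDFReal 0 1 with hρ
  set κ := ∫ s, k s ∂gaussianReal 0 1 with hκ
  have hρpos : ∀ t, 0 < ρ t := fun t => gaussianPDFReal_pos _ _ _ one_ne_zero
  have hρi : Integrable ρ := integrable_gaussianPDFReal 0 1
  have hρc : Continuous ρ :=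
    continuous_iff_continuousAt.2 fun t => (hasDerivAt_gaussianPDFReal t).continuousAt
  have hki : Integrable k (gaussianReal 0 1) :=
    Integrable.of_bound hk.aestronglyMeasurable 1 (ae_of_all _ fun x => by
      rw [Real.norm_eq_abs, abs_of_nonneg (h0 x)]; exact h1 x)
  have hκ0 : 0 ≤ κ := integral_nonneg h0
  have hκ1 : κ ≤ 1 := by
    calc κ ≤ ∫ _, (1 : ℝ) ∂gaussianReal 0 1 := integral_mono hki (integrable_const _) h1
      _ = 1 := by simp
  have hkκ : ∀ t, |k t - κ| ≤ 1 := fun t => by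
    rw [abs_le]; constructor <;> linarith [h0 t, h1 t]
  set g : ℝ → ℝ := fun t => (k t - κ) * ρ t with hg
  have hgc : Continuous g := (hk.sub continuous_const).mul hρc
  have hgle : ∀ t, |g t| ≤ ρ t := fun t => by
    rw [hg, abs_mul, abs_of_pos (hρpos t)]
    exact mul_le_of_le_one_left (hρpos t).le (hkκ t)
  have hgi : Integrable g := hρi.mono' hgc.aestronglyMeasurable (ae_of_all _ hgle)
  have hg0 : ∫ t, g t = 0 := by
    have e1 : ∫ t, (k t - κ) ∂gaussianReal 0 1 = 0 := by
      rw [integral_sub hki (integrable_const _)]; simp [hκ]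
    rw [integral_gaussianReal_eq_integral_smul one_ne_zero] at e1
    rw [← e1]; congr 1; ext t; simp only [hg, smul_eq_mul, mul_comm, hρ]
  set I : ℝ → ℝ := fun x => ∫ t in Set.Iic x, g t with hI
  have hId : ∀ x, HasDerivAt I (g x) x := fun x => by
    have e : I = fun y => I 0 + ∫ t in (0)..y, g t := by
      ext y
      rw [← intervalIntegral.integral_Iic_sub_Iic hgi.integrableOn hgi.integrableOn]
      simp only [hI]; ring
    rw [e]
    exact (intervalIntegral.integral_hasDerivAt_right (hgc.intervalIntegrable _ _)
      (hgc.stronglyMeasurableAtFilter _ _) hgc.continuousAt).const_add _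
  -- Since g has total integral zero, I is also minus the right tail. Using the right tail for x ≥ 0
  -- and the left one for x ≤ 0, the Mills bound applies on both sides.
  have hIneg : ∀ x, I x = - ∫ t in Set.Ioi x, g t := fun x => by
    have := intervalIntegral.integral_Iic_add_Ioi (b := x) hgi.integrableOn hgi.integrableOn
    rw [hg0] at this
    simp only [hI]; linarith
  have habs : ∀ x, |x * I x| ≤ ρ x := fun x => by
    rw [abs_mul]
    rcases le_total 0 x with hx | hx
    · rw [abs_of_nonneg hx, hIneg, abs_neg]
      refine le_trans (mul_le_mul_of_nonneg_left ?_ hx) (mul_integral_Ioi_gaussianPDFReal_le hx)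
      exact norm_integral_le_of_norm_le (f := g) hρi.integrableOn (ae_of_all _ hgle)
    · rw [abs_of_nonpos hx]
      refine le_trans (mul_le_mul_of_nonneg_left ?_ (neg_nonneg.2 hx))
        ((mul_integral_Ioi_gaussianPDFReal_le (neg_nonneg.2 hx)).trans_eq
          (gaussianPDFReal_neg_arg x))
      calc |I x| ≤ ∫ t in Set.Iic x, ρ t :=
            norm_integral_le_of_norm_le (f := g) hρi.integrableOn (ae_of_all _ hgle)
        _ = ∫ t in Set.Ioi (-x), ρ t := by
            rw [← integral_comp_neg_Iic]
            simp only [hρ, gaussianPDFReal_neg_arg]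
  refine ⟨fun x => I x / ρ x, fun x => x * (I x / ρ x) + (k x - κ), fun x => ?_, ?_, fun x => ?_,
    fun x => by ring⟩
  · refine ((hId x).div (hasDerivAt_gaussianPDFReal x) (hρpos x).ne').congr_deriv ?_
    have := (hρpos x).ne'
    simp only [hg, ← hρ]
    field_simp
    ring
  · have hIc : Continuous I := continuous_iff_continuousAt.2 fun x => (hId x).continuousAt
    exact (continuous_id.mul (hIc.div hρc fun x => (hρpos x).ne')).add (hk.sub continuous_const)
  -- The constant 2 is 1 + 1: Stein's equation writes φ' as xφ + (k - κ), and each summand is at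
  -- most 1 in modulus.
  · have e : |x * (I x / ρ x)| ≤ 1 := by
      rw [← mul_div_assoc, abs_div, abs_of_pos (hρpos x), div_le_one (hρpos x)]
      exact habs x
    calc _ ≤ |x * (I x / ρ x)| + |k x - κ| := abs_add_le _ _
      _ ≤ 2 := by linarith [hkκ x]

/-- The total variation distance is controlled by continuous test functions. -/
lemma tvDist_le_of_continuous {μ ν : Measure ℝ} [IsProbabilityMeasure μ] [IsProbabilityMeasure ν]
    {C : ℝ} (hC : ∀ k : ℝ → ℝ, Continuous k → (∀ x, 0 ≤ k x) → (∀ x, k x ≤ 1) →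
      |∫ x, k x ∂μ - ∫ x, k x ∂ν| ≤ C) : tvDist μ ν ≤ ENNReal.ofReal C := by
  refine iSup₂_le fun B hB => ENNReal.ofReal_le_ofReal (le_of_forall_pos_le_add fun ε hε => ?_)
  -- Approximating in L¹(μ + ν) lets a single continuous function serve both measures.
  have hf : Integrable (B.indicator fun _ => (1 : ℝ)) (μ + ν) :=
    (integrable_const 1).indicator hB
  obtain ⟨g, hg, hgi⟩ := hf.exists_boundedContinuous_integral_sub_le hε
  set f : ℝ → ℝ := B.indicator fun _ => (1 : ℝ) with hfdef
  -- Clamping to [0, 1] does not move g away from an indicator, and makes it an admissible test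
  -- function.
  set k : ℝ → ℝ := fun x => max 0 (min 1 (g x)) with hk
  have hkc : Continuous k := continuous_const.max (continuous_const.min g.continuous)
  have hk0 : ∀ x, 0 ≤ k x := fun x => le_max_left _ _
  have hk1 : ∀ x, k x ≤ 1 := fun x => max_le zero_le_one (min_le_left _ _)
  have hfk : ∀ x, |f x - k x| ≤ ‖f x - g x‖ := fun x => by
    rw [Real.norm_eq_abs]
    by_cases hx : x ∈ B
    · simp only [hfdef, hk, Set.indicator_of_mem hx]
      rcases le_total (g x) 1 with h | h <;> rcases le_total 0 (g x) with h' | h' <;>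
        simp [h, h', abs_of_nonneg, abs_of_nonpos]
    · simp only [hfdef, hk, Set.indicator_of_notMem hx]
      rcases le_total (g x) 1 with h | h <;> rcases le_total 0 (g x) with h' | h' <;>
        simp [h, h', abs_of_nonneg, abs_of_nonpos] <;> grind
  have hki : Integrable k (μ + ν) := Integrable.of_bound hkc.aestronglyMeasurable 1
    (ae_of_all _ fun x => by rw [Real.norm_eq_abs, abs_of_nonneg (hk0 x)]; exact hk1 x)
  have hfi := integrable_add_measure.1 hf
  have hki' := integrable_add_measure.1 hki
  have hdi : Integrable (fun x => |f x - k x|) (μ + ν) := (hf.sub hki).abs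
  have hd := integrable_add_measure.1 hdi
  have hle : ∫ x, |f x - k x| ∂μ + ∫ x, |f x - k x| ∂ν ≤ ε := by
    rw [← integral_add_measure hd.1 hd.2]
    exact (integral_mono hdi (hf.sub hgi).norm hfk).trans hg
  have eμ : μ.real B = ∫ x, f x ∂μ := by simp [hfdef, integral_indicator hB]
  have eν : ν.real B = ∫ x, f x ∂ν := by simp [hfdef, integral_indicator hB]
  have dμ : |∫ x, f x ∂μ - ∫ x, k x ∂μ| ≤ ∫ x, |f x - k x| ∂μ := by
    rw [← integral_sub hfi.1 hki'.1]; exact abs_integral_le_integral_abs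
  have dν : |∫ x, f x ∂ν - ∫ x, k x ∂ν| ≤ ∫ x, |f x - k x| ∂ν := by
    rw [← integral_sub hfi.2 hki'.2]; exact abs_integral_le_integral_abs
  have hkC := hC k hkc hk0 hk1
  rw [eμ, eν]
  rw [abs_le] at *
  constructor <;> linarith [dμ.1, dμ.2, dν.1, dν.2, hkC.1, hkC.2]

variable {ι : Type*} [Fintype ι] [DecidableEq ι] {h : (ι → ℝ) → ℝ} {d : ι → (ι → ℝ) → ℝ}

/-- **Second order Poincaré inequality**: the total variation distance of a function of a standard
gaussian vector to the normal distribution with the same mean and variance. -/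
theorem tvDist_map_gaussianReal_le
    (hd : ∀ x, HasFDerivAt h (∑ i, d i x • ContinuousLinearMap.proj (R := ℝ) i) x)
    (hdc : ∀ i, ContDiff ℝ 1 (d i))
    (hh2 : MemLp h 2 (stdGaussianPi ι)) (hd2 : ∀ i, MemLp (d i) 2 (stdGaussianPi ι))
    {K : ℝ≥0∞} (hKtop : K ≠ ∞)
    (hK : ∀ ρ : Measure ((ι → ℝ) × (ι → ℝ)), MeasurePreserving Prod.fst ρ (stdGaussianPi ι) →
      MeasurePreserving Prod.snd ρ (stdGaussianPi ι) →
      ∫⁻ z, ENNReal.ofReal (hessGradNorm d z) ∂ρ ≤ K)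
    (hv : 0 < variance h (stdGaussianPi ι)) :
    tvDist ((stdGaussianPi ι).map h) (gaussianReal (∫ x, h x ∂stdGaussianPi ι)
      (variance h (stdGaussianPi ι)).toNNReal) ≤
      ENNReal.ofReal (2 * Real.pi / variance h (stdGaussianPi ι) * K.toReal) := by
  set γ := stdGaussianPi ι with hγ
  set m := ∫ x, h x ∂γ with hm
  set v := variance h γ with hvdef
  have hhc : Continuous h := continuous_iff_continuousAt.2 fun x => (hd x).continuousAt
  have : IsProbabilityMeasure (γ.map h) := Measure.isProbabilityMeasure_map hhc.aemeasurable
  set σ := √v with hσ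
  have hσ0 : 0 < σ := Real.sqrt_pos.2 hv
  have hσ2 : σ * σ = v := Real.mul_self_sqrt hv.le
  refine tvDist_le_of_continuous fun k hk h0 h1 => ?_
  obtain ⟨φ, φ', hφ, hφc, hφ2, hst⟩ := exists_stein_solution (k := fun x => k (σ * x + m))
    (by fun_prop) (fun x => h0 _) (fun x => h1 _)
  have hκ : ∫ s, k (σ * s + m) ∂gaussianReal 0 1 = ∫ x, k x ∂gaussianReal m v.toNNReal := by
    have e : gaussianReal m v.toNNReal = (gaussianReal 0 1).map (fun x => σ * x + m) := by
      have e1 : (fun x => σ * x + m) = (fun x => x + m) ∘ (fun x => σ * x) := rfl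
      rw [e1, ← Measure.map_map (by fun_prop) (by fun_prop), gaussianReal_map_const_mul,
        gaussianReal_map_add_const]
      congr 1
      · simp
      · ext; simp [hv.le, hσ, Real.sq_sqrt hv.le]
    rw [e, integral_map (by fun_prop) hk.aestronglyMeasurable]
  -- With ψ(t) = φ((t - m)/σ)/σ and N = (W - m)/σ, the quantity v E ψ'(W) - Cov(ψ(W), W) equals
  -- E[φ'(N) - N φ(N)], the Stein expression for the standardised variable.
  have hψ : ∀ t, HasDerivAt (fun t => φ ((t - m) / σ) / σ) (φ' ((t - m) / σ) / v) t := fun t => by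
    have e1 : HasDerivAt (fun t => (t - m) / σ) (1 / σ) t :=
      ((hasDerivAt_id t).sub_const m).div_const σ
    refine (((hφ _).comp t e1).div_const σ).congr_deriv ?_
    rw [← hσ2]; field_simp
  have hψC : ∀ t, |φ' ((t - m) / σ) / v| ≤ 2 / v := fun t => by
    rw [abs_div, abs_of_pos hv]
    exact div_le_div_of_nonneg_right (hφ2 _) hv.le
  have hψc : Continuous fun t => φ' ((t - m) / σ) / v := by fun_prop
  have main := abs_variance_mul_sub_covariance_le hd hdc hh2 hd2 hψ hψc hψC hKtop hK
  have hψ2 := memLp_two_comp_of_deriv_le hh2 hψ hψC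
  have hφc0 : Continuous φ := continuous_iff_continuousAt.2 fun t => (hφ t).continuousAt
  have i1 : Integrable (fun x => φ' ((h x - m) / σ) / v) γ :=
    Integrable.of_bound (hψc.comp hhc).aestronglyMeasurable (2 / v) (ae_of_all _ fun x => hψC _)
  have i2 : Integrable (fun x => φ ((h x - m) / σ) / σ * h x) γ := hψ2.integrable_mul hh2
  have i3 : Integrable (fun x => φ ((h x - m) / σ) / σ) γ := hψ2.integrable one_le_two
  have i4 : Integrable (fun x => φ ((h x - m) / σ) / σ * h x - φ ((h x - m) / σ) / σ * m) γ :=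
    i2.sub (i3.mul_const m)
  have ik : Integrable (fun x => k (h x)) γ :=
    Integrable.of_bound (hk.comp hhc).aestronglyMeasurable 1 (ae_of_all _ fun x => by
      rw [Real.norm_eq_abs, abs_of_nonneg (h0 _)]; exact h1 _)
  have key : v * ∫ x, φ' ((h x - m) / σ) / v ∂γ -
      (∫ x, φ ((h x - m) / σ) / σ * h x ∂γ - (∫ x, φ ((h x - m) / σ) / σ ∂γ) * m) =
      ∫ x, k x ∂γ.map h - ∫ x, k x ∂gaussianReal m v.toNNReal := by
    rw [← integral_const_mul, ← integral_mul_const, ← integral_sub i2 (i3.mul_const m),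
      ← integral_sub (i1.const_mul v) i4,
      integral_map hhc.aemeasurable hk.aestronglyMeasurable, ← hκ]
    have e : ∫ x, (k (h x) - ∫ s, k (σ * s + m) ∂gaussianReal 0 1) ∂γ =
        ∫ x, k (h x) ∂γ - ∫ s, k (σ * s + m) ∂gaussianReal 0 1 := by
      rw [integral_sub ik (integrable_const _)]; simp
    rw [← e]
    congr 1; ext x
    have := hst ((h x - m) / σ)
    have e2 : σ * ((h x - m) / σ) + m = h x := by field_simp; ring
    rw [e2] at this
    rw [← this]
    field_simp
  rw [key] at main
  refine main.trans (le_of_eq ?_)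
  ring

end Stein

/-! ### Entire power series on a Banach algebra -/

section PowerSeries

/-- The coefficients of an everywhere convergent power series. -/
def EntireCoeff (c : ℕ → ℂ) : Prop := ∀ r : ℝ, 0 ≤ r → Summable fun m => ‖c m‖ * r ^ m

/-- The coefficients of the derivative of a power series. -/
def derivCoeff (c : ℕ → ℂ) (m : ℕ) : ℂ := ((m : ℂ) + 1) * c (m + 1)

lemma norm_derivCoeff (c : ℕ → ℂ) (m : ℕ) : ‖derivCoeff c m‖ = ((m : ℝ) + 1) * ‖c (m + 1)‖ := by
  rw [derivCoeff, norm_mul]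
  congr 1
  exact_mod_cast Complex.norm_natCast (m + 1)

lemma entireCoeff_coeff {f : ℂ → ℂ} (hf : Differentiable ℂ f) : EntireCoeff (coeff f) := by
  intro r hr
  have := (Complex.hasSum_taylorSeries_of_entire hf 0 (r : ℂ)).summable.norm
  refine this.congr fun m => ?_
  simp only [sub_zero, smul_eq_mul, norm_mul, norm_pow, Complex.norm_real, Real.norm_of_nonneg hr,
    coeff, norm_div, norm_inv]
  ring

lemma EntireCoeff.derivCoeff {c : ℕ → ℂ} (hc : EntireCoeff c) : EntireCoeff (derivCoeff c) := by
  intro r hr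
  -- The factor 2 absorbs m + 1 ≤ 2^(m+1); the summand 1 allows r^m ≤ (r+1)^(m+1) even when r < 1.
  have h := (hc (2 * (r + 1)) (by positivity)).comp_injective (add_left_injective 1)
  refine Summable.of_nonneg_of_le (fun m => by positivity) (fun m => ?_) h
  simp only [Function.comp_apply, norm_derivCoeff]
  have h1 : ((m : ℝ) + 1) ≤ 2 ^ (m + 1) := by
    exact_mod_cast (Nat.lt_two_pow_self (n := m + 1)).le
  have h2 : r ^ m ≤ (r + 1) ^ (m + 1) := by
    calc r ^ m ≤ (r + 1) ^ m := by gcongr; linarith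
      _ ≤ (r + 1) ^ (m + 1) := pow_le_pow_right₀ (by linarith) (Nat.le_succ m)
  calc ((m : ℝ) + 1) * ‖c (m + 1)‖ * r ^ m
      ≤ 2 ^ (m + 1) * ‖c (m + 1)‖ * (r + 1) ^ (m + 1) := by gcongr
    _ = _ := by rw [mul_pow]; ring

/-- `∑ m |c_m| r ^ (m - 1)`, by a shift of the index. -/
lemma EntireCoeff.hasSum_nat_mul {c : ℕ → ℂ} (hc : EntireCoeff c) {r : ℝ} (hr : 0 ≤ r) :
    HasSum (fun m : ℕ => (m : ℝ) * ‖c m‖ * r ^ (m - 1))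
      (∑' m, ‖WignerCLT.derivCoeff c m‖ * r ^ m) := by
  have h := (hc.derivCoeff r hr).hasSum
  -- The m = 0 term carries the factor m, so the truncated exponent `0 - 1` is harmless.
  rw [← hasSum_nat_add_iff' 1]
  simp only [Finset.sum_range_one, Nat.cast_zero, zero_mul, sub_zero]
  refine h.congr_fun fun m => ?_
  rw [norm_derivCoeff]; push_cast; rfl

variable {𝔸 : Type*} [NormedRing 𝔸] [NormedAlgebra ℂ 𝔸]

/-- The function `∑ c_m A ^ m` on a Banach algebra. -/
def powerFun (c : ℕ → ℂ) (A : 𝔸) : 𝔸 := ∑' m : ℕ, c m • A ^ m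

variable {c : ℕ → ℂ}

/-- The derivative of `A ↦ A ^ m`. -/
def powDeriv (A : 𝔸) (m : ℕ) : 𝔸 →L[ℂ] 𝔸 :=
  ∑ i ∈ Finset.range m, MulOpposite.op (A ^ i) • (A ^ (m.pred - i) • ContinuousLinearMap.id ℂ 𝔸)

lemma powDeriv_apply (A H : 𝔸) (m : ℕ) :
    powDeriv A m H = ∑ i ∈ Finset.range m, A ^ (m - 1 - i) * H * A ^ i := by
  simp [powDeriv, sum_apply]

lemma hasFDerivAt_pow_powDeriv (A : 𝔸) (m : ℕ) :
    HasFDerivAt (fun B : 𝔸 => B ^ m) (powDeriv A m) A := by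
  refine (hasFDerivAt_pow' (𝕜 := ℂ) m (x := A)).congr_fderiv ?_
  ext H
  simp [powDeriv, sum_apply, mul_assoc]

variable [NormOneClass 𝔸]

lemma EntireCoeff.norm_powerFun_le (hc : EntireCoeff c) (A : 𝔸) :
    ‖powerFun c A‖ ≤ ∑' m, ‖c m‖ * ‖A‖ ^ m := by
  refine tsum_of_norm_bounded (hc ‖A‖ (norm_nonneg _)).hasSum fun m => ?_
  rw [norm_smul]
  gcongr
  exact norm_pow_le A m

lemma norm_powDeriv_le (A : 𝔸) (m : ℕ) : ‖powDeriv A m‖ ≤ m * ‖A‖ ^ (m - 1) := by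
  refine ContinuousLinearMap.opNorm_le_bound _ (by positivity) fun H => ?_
  rw [powDeriv_apply]
  calc ‖∑ i ∈ Finset.range m, A ^ (m - 1 - i) * H * A ^ i‖
      ≤ ∑ i ∈ Finset.range m, ‖A‖ ^ (m - 1) * ‖H‖ := by
        refine norm_sum_le_of_le _ fun i hi => ?_
        have hi' : m - 1 = (m - 1 - i) + i := by
          have := Finset.mem_range.1 hi; omega
        calc ‖A ^ (m - 1 - i) * H * A ^ i‖ ≤ ‖A‖ ^ (m - 1 - i) * ‖H‖ * ‖A‖ ^ i := by
              refine (norm_mul_le _ _).trans ?_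
              gcongr
              · refine (norm_mul_le _ _).trans ?_
                gcongr
                exact norm_pow_le _ _
              · exact norm_pow_le _ _
          _ = ‖A‖ ^ ((m - 1 - i) + i) * ‖H‖ := by rw [pow_add]; ring
          _ = _ := by rw [← hi']
    _ = m * ‖A‖ ^ (m - 1) * ‖H‖ := by simp [mul_assoc]

variable [CompleteSpace 𝔸]

lemma EntireCoeff.summable_smul_pow (hc : EntireCoeff c) (A : 𝔸) :
    Summable fun m : ℕ => c m • A ^ m := by
  refine Summable.of_norm_bounded (hc ‖A‖ (norm_nonneg _)) fun m => ?_
  rw [norm_smul]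
  gcongr
  exact norm_pow_le A m

lemma EntireCoeff.contDiff_powerFun (hc : EntireCoeff c) (N : WithTop ℕ∞) :
    ContDiff ℂ N (powerFun c : 𝔸 → 𝔸) := by
  have hrad : (FormalMultilinearSeries.ofScalars 𝔸 c).radius = ⊤ := by
    refine FormalMultilinearSeries.radius_eq_top_of_summable_norm _ fun r => ?_
    refine (hc r r.2).congr fun m => ?_
    rw [FormalMultilinearSeries.ofScalars_norm]
  have hball := (FormalMultilinearSeries.ofScalars 𝔸 c).hasFPowerSeriesOnBall (by simp [hrad])
  have : (FormalMultilinearSeries.ofScalars 𝔸 c).sum = (powerFun c : 𝔸 → 𝔸) := by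
    ext A
    exact FormalMultilinearSeries.ofScalars_sum_eq c A
  rw [this, hrad] at hball
  have han : AnalyticOnNhd ℂ (powerFun c : 𝔸 → 𝔸) Set.univ := by
    have := hball.analyticOnNhd
    rwa [Metric.eball_top] at this
  exact han.contDiff

lemma EntireCoeff.summable_smul_powDeriv (hc : EntireCoeff c) (A : 𝔸) :
    Summable fun m : ℕ => c m • powDeriv A m := by
  refine Summable.of_norm_bounded (hc.hasSum_nat_mul (norm_nonneg A)).summable fun m => ?_
  rw [norm_smul]
  calc ‖c m‖ * ‖powDeriv A m‖ ≤ ‖c m‖ * (m * ‖A‖ ^ (m - 1)) := by gcongr; exact norm_powDeriv_le A m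
    _ = _ := by ring

/-- Termwise differentiation on the ball of radius ‖A‖ + 1, where the derivatives are uniformly
dominated. Smoothness alone is given by analyticity; the explicit series is what the trace estimates
need. -/
lemma EntireCoeff.hasFDerivAt_powerFun (hc : EntireCoeff c) (A : 𝔸) :
    HasFDerivAt (powerFun c : 𝔸 → 𝔸) (∑' m, c m • powDeriv A m) A := by
  have hR0 : 0 ≤ ‖A‖ + 1 := by positivity
  have hA : A ∈ Metric.ball (0 : 𝔸) (‖A‖ + 1) := by simp
  have h1 : ∀ (m : ℕ) (B : 𝔸), B ∈ Metric.ball (0 : 𝔸) (‖A‖ + 1) →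
      HasFDerivAt (fun B : 𝔸 => c m • B ^ m) (c m • powDeriv B m) B := fun m B _ =>
    (hasFDerivAt_pow_powDeriv B m).const_smul (c m)
  have h2 : ∀ (m : ℕ) (B : 𝔸), B ∈ Metric.ball (0 : 𝔸) (‖A‖ + 1) →
      ‖c m • powDeriv B m‖ ≤ (m : ℝ) * ‖c m‖ * (‖A‖ + 1) ^ (m - 1) := fun m B hB => by
    rw [norm_smul]
    have hB' : ‖B‖ ≤ ‖A‖ + 1 := (mem_ball_zero_iff.1 hB).le
    calc ‖c m‖ * ‖powDeriv B m‖ ≤ ‖c m‖ * (m * ‖B‖ ^ (m - 1)) := by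
          gcongr; exact norm_powDeriv_le B m
      _ ≤ ‖c m‖ * (m * (‖A‖ + 1) ^ (m - 1)) := by gcongr
      _ = _ := by ring
  exact hasFDerivAt_tsum_of_isPreconnected (hc.hasSum_nat_mul hR0).summable Metric.isOpen_ball
    (convex_ball _ _).isPreconnected h1 h2 hA (hc.summable_smul_pow A) hA

lemma EntireCoeff.fderiv_powerFun_apply (hc : EntireCoeff c) (A H : 𝔸) :
    HasSum (fun m => c m • ∑ i ∈ Finset.range m, A ^ (m - 1 - i) * H * A ^ i)
      (fderiv ℂ (powerFun c : 𝔸 → 𝔸) A H) := by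
  rw [(hc.hasFDerivAt_powerFun A).fderiv]
  have := (ContinuousLinearMap.apply ℂ 𝔸 H).hasSum (hc.summable_smul_powDeriv A).hasSum
  refine this.congr_fun fun m => ?_
  simp [powDeriv_apply]

end PowerSeries

/-! ### Trace inequalities and the linear map to Wigner matrices -/

section MatrixBounds

open Matrix
open scoped Matrix.Norms.L2Operator

variable {n : ℕ}

/-- The Hilbert–Schmidt norm. -/
def hsNorm (A : Matrix (Fin n) (Fin n) ℂ) : ℝ := √(∑ i, ∑ j, ‖A i j‖ ^ 2)

lemma hsNorm_nonneg (A : Matrix (Fin n) (Fin n) ℂ) : 0 ≤ hsNorm A := Real.sqrt_nonneg _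

lemma hsNorm_sq (A : Matrix (Fin n) (Fin n) ℂ) : hsNorm A ^ 2 = ∑ i, ∑ j, ‖A i j‖ ^ 2 :=
  Real.sq_sqrt (by positivity)

lemma hsNorm_conjTranspose (A : Matrix (Fin n) (Fin n) ℂ) : hsNorm Aᴴ = hsNorm A := by
  unfold hsNorm
  rw [Finset.sum_comm]
  simp

lemma hsNorm_one : hsNorm (1 : Matrix (Fin n) (Fin n) ℂ) = √(n : ℝ) := by
  unfold hsNorm
  congr 1
  simp [Matrix.one_apply, apply_ite (fun z : ℂ => ‖z‖ ^ 2)]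

lemma sum_norm_mulVec_sq_le (A : Matrix (Fin n) (Fin n) ℂ) (v : Fin n → ℂ) :
    ∑ i, ‖(A *ᵥ v) i‖ ^ 2 ≤ ‖A‖ ^ 2 * ∑ i, ‖v i‖ ^ 2 := by
  have h := l2_opNorm_mulVec A (WithLp.toLp 2 v)
  have h2 := pow_le_pow_left₀ (norm_nonneg _) h 2
  rw [mul_pow, EuclideanSpace.norm_sq_eq, EuclideanSpace.norm_sq_eq] at h2
  exact h2

/-- Apply the operator norm bound to each column of B and sum the squares. -/
lemma hsNorm_mul_le (A B : Matrix (Fin n) (Fin n) ℂ) : hsNorm (A * B) ≤ ‖A‖ * hsNorm B := by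
  refine abs_le_of_sq_le_sq' ?_ (mul_nonneg (norm_nonneg _) (hsNorm_nonneg _)) |>.2
  rw [mul_pow, hsNorm_sq, hsNorm_sq, Finset.sum_comm, Finset.sum_comm (f := fun i j => ‖B i j‖ ^ 2),
    Finset.mul_sum]
  exact Finset.sum_le_sum fun j _ => sum_norm_mulVec_sq_le A fun i => B i j

lemma hsNorm_mul_le' (A B : Matrix (Fin n) (Fin n) ℂ) : hsNorm (A * B) ≤ hsNorm A * ‖B‖ := by
  rw [← hsNorm_conjTranspose, conjTranspose_mul, ← hsNorm_conjTranspose A,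
    ← l2_opNorm_conjTranspose B, mul_comm (hsNorm _)]
  exact hsNorm_mul_le _ _

lemma hsNorm_le (A : Matrix (Fin n) (Fin n) ℂ) : hsNorm A ≤ ‖A‖ * √(n : ℝ) := by
  have := hsNorm_mul_le A 1
  rwa [mul_one, hsNorm_one] at this

lemma norm_apply_le (A : Matrix (Fin n) (Fin n) ℂ) (i j : Fin n) : ‖A i j‖ ≤ ‖A‖ := by
  have h := sum_norm_mulVec_sq_le A (Pi.single j 1)
  have h1 : ∑ k, ‖(Pi.single j 1 : Fin n → ℂ) k‖ ^ 2 = 1 := by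
    simp [Pi.single_apply, apply_ite (fun z : ℂ => ‖z‖ ^ 2)]
  rw [h1, mul_one] at h
  refine abs_le_of_sq_le_sq' ?_ (norm_nonneg _) |>.2
  refine le_trans ?_ h
  have := Finset.single_le_sum (f := fun i => ‖(A *ᵥ Pi.single j 1) i‖ ^ 2)
    (fun i _ => by positivity) (Finset.mem_univ i)
  simpa using this

lemma norm_trace_mul_le (A B : Matrix (Fin n) (Fin n) ℂ) :
    ‖(A * B).trace‖ ≤ hsNorm A * hsNorm B := by
  have e : (A * B).trace = ∑ p : Fin n × Fin n, A p.1 p.2 * B p.2 p.1 := by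
    rw [Fintype.sum_prod_type]; rfl
  rw [e]
  calc ‖∑ p : Fin n × Fin n, A p.1 p.2 * B p.2 p.1‖
      ≤ ∑ p : Fin n × Fin n, ‖A p.1 p.2‖ * ‖B p.2 p.1‖ :=
        norm_sum_le_of_le _ fun p _ => norm_mul_le _ _
    _ ≤ √(∑ p : Fin n × Fin n, ‖A p.1 p.2‖ ^ 2) * √(∑ p : Fin n × Fin n, ‖B p.2 p.1‖ ^ 2) :=
        Real.sum_mul_le_sqrt_mul_sqrt _ _ _
    _ = _ := by
        rw [Fintype.sum_prod_type, Fintype.sum_prod_type_right]; rfl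

/-- Only the two directions V, W are measured in Hilbert–Schmidt norm; keeping A and B in operator
norm avoids any loss in n. -/
lemma norm_trace_mul_mul_mul_le (A V B W : Matrix (Fin n) (Fin n) ℂ) :
    ‖(A * V * B * W).trace‖ ≤ ‖A‖ * ‖B‖ * (hsNorm V * hsNorm W) := by
  calc _ ≤ hsNorm (A * V * B) * hsNorm W := norm_trace_mul_le _ _
    _ ≤ (‖A‖ * hsNorm V * ‖B‖) * hsNorm W := by
        gcongr
        · exact hsNorm_nonneg _
        · refine (hsNorm_mul_le' _ _).trans ?_
          gcongr
          exact hsNorm_mul_le _ _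
    _ = _ := by ring

section Derivatives

variable [NeZero n] {c : ℕ → ℂ}

/-- The derivative of `A ↦ Tr ∑ c_m A ^ m`. -/
lemma trace_fderiv_powerFun (hc : EntireCoeff c) (A H : Matrix (Fin n) (Fin n) ℂ) :
    (fderiv ℂ (powerFun c) A H).trace = (powerFun (derivCoeff c) A * H).trace := by
  have h1 := (hc.fderiv_powerFun_apply A H).map (traceAddMonoidHom (Fin n) ℂ)
    (Continuous.matrix_trace continuous_id)
  have h2 := (((hc.derivCoeff.summable_smul_pow A).hasSum).mul_right H).map
    (traceAddMonoidHom (Fin n) ℂ) (Continuous.matrix_trace continuous_id)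
  rw [← hasSum_nat_add_iff' 1] at h1
  simp only [Finset.sum_range_one, Finset.range_zero, Finset.sum_empty, Function.comp_apply,
    smul_zero, map_zero, sub_zero] at h1
  refine h1.unique (h2.congr_fun fun m => ?_)
  simp only [Function.comp_apply, traceAddMonoidHom_apply, trace_smul, trace_sum,
    Nat.add_sub_cancel, smul_mul_assoc]
  -- Cyclicity of the trace merges the m + 1 noncommutative terms of the derivative into one, as for
  -- a scalar variable.
  have : ∀ i ∈ Finset.range (m + 1), (A ^ (m - i) * H * A ^ i).trace = (A ^ m * H).trace := by
    intro i hi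
    rw [trace_mul_comm, ← mul_assoc, ← pow_add]
    congr 3
    have := Finset.mem_range.1 hi; omega
  rw [Finset.sum_congr rfl this]
  simp only [Finset.sum_const, Finset.card_range, derivCoeff, smul_eq_mul, nsmul_eq_mul]
  push_cast; ring

lemma norm_trace_fderiv_powerFun_mul_le (hc : EntireCoeff c) (A V W : Matrix (Fin n) (Fin n) ℂ) :
    ‖(fderiv ℂ (powerFun c) A V * W).trace‖ ≤
      (∑' m : ℕ, (m : ℝ) * ‖c m‖ * ‖A‖ ^ (m - 1)) * (hsNorm V * hsNorm W) := by
  have h1 := ((hc.fderiv_powerFun_apply A V).mul_right W).map (traceAddMonoidHom (Fin n) ℂ)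
    (Continuous.matrix_trace continuous_id)
  have hs := (hc.hasSum_nat_mul (norm_nonneg A)).summable.hasSum.mul_right (hsNorm V * hsNorm W)
  have := h1.tsum_eq
  simp only [traceAddMonoidHom_apply] at this
  rw [← this]
  refine tsum_of_norm_bounded hs fun m => ?_
  simp only [Function.comp_apply, traceAddMonoidHom_apply, smul_mul_assoc, trace_smul,
    Finset.sum_mul, trace_sum, smul_eq_mul, norm_mul]
  calc ‖c m‖ * ‖∑ i ∈ Finset.range m, (A ^ (m - 1 - i) * V * A ^ i * W).trace‖
      ≤ ‖c m‖ * ∑ i ∈ Finset.range m, ‖A‖ ^ (m - 1) * (hsNorm V * hsNorm W) := by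
        gcongr
        refine norm_sum_le_of_le _ fun i hi => ?_
        refine (norm_trace_mul_mul_mul_le _ _ _ _).trans ?_
        have := hsNorm_nonneg V
        have := hsNorm_nonneg W
        gcongr
        calc ‖A ^ (m - 1 - i)‖ * ‖A ^ i‖ ≤ ‖A‖ ^ (m - 1 - i) * ‖A‖ ^ i := by
              gcongr <;> exact norm_pow_le _ _
          _ = ‖A‖ ^ (m - 1) := by
              rw [← pow_add]; congr 1
              have := Finset.mem_range.1 hi; omega
    _ = _ := by simp; ring

end Derivatives

section Wigner

lemma wignerMatrix_add (x y : UpperIndex n → ℝ) :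
    wignerMatrix n (x + y) = wignerMatrix n x + wignerMatrix n y := by
  ext i j; simp [wignerMatrix, add_div]

lemma wignerMatrix_smul (r : ℝ) (x : UpperIndex n → ℝ) :
    wignerMatrix n (r • x) = r • wignerMatrix n x := by
  ext i j; simp [wignerMatrix, mul_div_assoc]

/-- The Wigner matrix, as a linear function of its upper triangular entries. -/
def wignerCLM (n : ℕ) : (UpperIndex n → ℝ) →L[ℝ] Matrix (Fin n) (Fin n) ℂ :=
  LinearMap.toContinuousLinearMap
    { toFun := wignerMatrix n
      map_add' := wignerMatrix_add
      map_smul' := wignerMatrix_smul }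

@[simp] lemma wignerCLM_apply (x : UpperIndex n → ℝ) : wignerCLM n x = wignerMatrix n x := rfl

lemma isHermitian_wignerMatrix (x : UpperIndex n → ℝ) : (wignerMatrix n x).IsHermitian := by
  ext i j
  simp only [wignerMatrix, conjTranspose_apply, of_apply, RCLike.star_def, Complex.conj_ofReal]
  simp only [min_comm j i, max_comm j i]

/-- Spectral radius and operator norm agree for self-adjoint elements; this turns every norm bound
into a bound in λ. -/
lemma specRadius_wignerMatrix (x : UpperIndex n → ℝ) :
    specRadius (wignerMatrix n x) = ‖wignerMatrix n x‖ := by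
  have := IsSelfAdjoint.spectralRadius_eq_nnnorm (A := Matrix (Fin n) (Fin n) ℂ)
    (isHermitian_wignerMatrix x).isSelfAdjoint
  rw [specRadius, this]; simp

/-- Summing a nonnegative function of the upper triangular index over all matrix entries counts
every index at most twice. -/
lemma sum_sum_upperIndex_le (g : UpperIndex n → ℝ) (hg : ∀ k, 0 ≤ g k) :
    ∑ i, ∑ j, g ⟨(min i j, max i j), min_le_max⟩ ≤ 2 * ∑ k, g k := by
  classical
  set G : Fin n × Fin n → ℝ := fun p => g ⟨(min p.1 p.2, max p.1 p.2), min_le_max⟩ with hG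
  have hG0 : ∀ p, 0 ≤ G p := fun p => hg _
  have hsw : ∀ p : Fin n × Fin n, G p.swap = G p := fun p => by
    simp only [hG, Prod.fst_swap, Prod.snd_swap, min_comm p.2, max_comm p.2]
  have hup : ∑ p ∈ Finset.univ.filter (fun p : Fin n × Fin n => p.1 ≤ p.2), G p = ∑ k, g k := by
    rw [← Finset.sum_subtype_eq_sum_filter, Finset.subtype_univ]
    refine Finset.sum_congr rfl fun k _ => ?_
    simp only [hG]
    congr 1
    exact Subtype.ext (Prod.ext (min_eq_left k.2) (max_eq_right k.2))
  have hlow : ∑ p ∈ Finset.univ.filter (fun p : Fin n × Fin n => p.2 ≤ p.1), G p = ∑ k, g k := by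
    rw [← hup]
    refine Finset.sum_bij' (fun p _ => p.swap) (fun p _ => p.swap) ?_ ?_ ?_ ?_ ?_ <;>
      simp [hsw]
  calc ∑ i, ∑ j, g ⟨(min i j, max i j), min_le_max⟩ = ∑ p : Fin n × Fin n, G p := by
        rw [Fintype.sum_prod_type]
    -- The two triangles cover all positions and overlap on the diagonal, where nonnegativity makes
    -- the double count an upper bound.
    _ ≤ ∑ p ∈ Finset.univ.filter (fun p : Fin n × Fin n => p.1 ≤ p.2), G p +
        ∑ p ∈ Finset.univ.filter (fun p : Fin n × Fin n => p.2 ≤ p.1), G p := by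
        rw [Finset.sum_filter, Finset.sum_filter, ← Finset.sum_add_distrib]
        refine Finset.sum_le_sum fun p _ => ?_
        rcases le_total p.1 p.2 with h | h <;> simp only [h, if_true] <;> split_ifs <;>
          linarith [hG0 p]
    _ = _ := by rw [hup, hlow]; ring

lemma hsNorm_wignerMatrix_sq_le (x : UpperIndex n → ℝ) :
    hsNorm (wignerMatrix n x) ^ 2 ≤ 2 / n * ∑ k, x k ^ 2 := by
  rw [hsNorm_sq]
  have := sum_sum_upperIndex_le (fun k => x k ^ 2 / n) (fun k => by positivity)
  calc _ = ∑ i, ∑ j, (x ⟨(min i j, max i j), min_le_max⟩) ^ 2 / (n : ℝ) := by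
        refine Finset.sum_congr rfl fun i _ => Finset.sum_congr rfl fun j _ => ?_
        simp only [wignerMatrix, of_apply, Complex.norm_real, Real.norm_eq_abs, sq_abs, div_pow]
        rw [Real.sq_sqrt (Nat.cast_nonneg n)]
    _ ≤ _ := this
    _ = _ := by rw [← Finset.sum_div]; ring

/-- The euclidean norm of a finite real vector. -/
def vecNorm {ι : Type*} [Fintype ι] (x : ι → ℝ) : ℝ := √(∑ k, x k ^ 2)

lemma vecNorm_nonneg {ι : Type*} [Fintype ι] (x : ι → ℝ) : 0 ≤ vecNorm x := Real.sqrt_nonneg _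

lemma vecNorm_sq {ι : Type*} [Fintype ι] (x : ι → ℝ) : vecNorm x ^ 2 = ∑ k, x k ^ 2 :=
  Real.sq_sqrt (by positivity)

lemma hsNorm_wignerMatrix_le (x : UpperIndex n → ℝ) :
    hsNorm (wignerMatrix n x) ≤ √(2 / n) * vecNorm x := by
  refine abs_le_of_sq_le_sq' ?_ (mul_nonneg (Real.sqrt_nonneg _) (vecNorm_nonneg _)) |>.2
  rw [mul_pow, vecNorm_sq, Real.sq_sqrt (by positivity)]
  exact hsNorm_wignerMatrix_sq_le x

/-- `Re Tr(B M(e_k))`, the `k`-th partial derivative of a linear statistic with matrix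
derivative `B`. -/
def traceCoord (B : Matrix (Fin n) (Fin n) ℂ) (k : UpperIndex n) : ℝ :=
  (B * wignerMatrix n (Pi.single k 1)).trace.re

lemma wignerMatrix_eq_sum (v : UpperIndex n → ℝ) :
    wignerMatrix n v = ∑ k, v k • wignerMatrix n (Pi.single k 1) := by
  have := congrArg (wignerCLM n) (pi_eq_sum_univ' v)
  simpa only [map_sum, map_smul, wignerCLM_apply] using this

lemma re_trace_mul_wignerMatrix (B : Matrix (Fin n) (Fin n) ℂ) (v : UpperIndex n → ℝ) :
    (B * wignerMatrix n v).trace.re = ∑ k, v k * traceCoord B k := by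
  rw [wignerMatrix_eq_sum, Finset.mul_sum, trace_sum, Complex.re_sum]
  refine Finset.sum_congr rfl fun k _ => ?_
  rw [mul_smul_comm, trace_smul, Complex.smul_re, traceCoord, smul_eq_mul]

/-- Duality for the euclidean norm. -/
lemma vecNorm_le_of_sum_sq_le {ι : Type*} [Fintype ι] {q : ι → ℝ} {C : ℝ} (hC : 0 ≤ C)
    (h : ∑ k, q k * q k ≤ C * vecNorm q) : vecNorm q ≤ C := by
  have h1 : vecNorm q * vecNorm q ≤ C * vecNorm q := by
    rw [← sq, vecNorm_sq]; simpa [sq] using h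
  rcases (vecNorm_nonneg q).eq_or_lt with h0 | h0
  · rw [← h0]; exact hC
  · exact le_of_mul_le_mul_right h1 h0

/-- By duality, test the vector against itself. Passing from operator to Hilbert–Schmidt norm costs
√n and the map to matrices gains √(2/n), so the dimension cancels. -/
lemma vecNorm_traceCoord_le [NeZero n] (B : Matrix (Fin n) (Fin n) ℂ) :
    vecNorm (traceCoord B) ≤ √2 * ‖B‖ := by
  have hn : (0 : ℝ) < n := by exact_mod_cast Nat.pos_of_neZero n
  refine vecNorm_le_of_sum_sq_le (by positivity) ?_
  rw [← re_trace_mul_wignerMatrix]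
  calc _ ≤ ‖(B * wignerMatrix n (traceCoord B)).trace‖ := Complex.re_le_norm _
    _ ≤ hsNorm B * hsNorm (wignerMatrix n (traceCoord B)) := norm_trace_mul_le _ _
    _ ≤ (‖B‖ * √(n : ℝ)) * (√(2 / n) * vecNorm (traceCoord B)) := by
        gcongr
        · exact hsNorm_nonneg _
        · exact hsNorm_le B
        · exact hsNorm_wignerMatrix_le _
    _ = ‖B‖ * (√(n : ℝ) * √(2 / n)) * vecNorm (traceCoord B) := by ring
    _ = √2 * ‖B‖ * vecNorm (traceCoord B) := by
        rw [← Real.sqrt_mul hn.le, mul_div_cancel₀ _ hn.ne']; ring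

/-- The matrix of a coordinate vector has at most two nonzero entries, each 1/√n. This
coordinatewise bound is the source of the factor 1/√n in the term with c₂. -/
lemma abs_traceCoord_le (B : Matrix (Fin n) (Fin n) ℂ) (k : UpperIndex n) :
    |traceCoord B k| ≤ 2 / √(n : ℝ) * ‖B‖ := by
  have hsum := sum_sum_upperIndex_le (fun l => (Pi.single k 1 : UpperIndex n → ℝ) l / √(n : ℝ))
    (fun l => by
      have : (0 : ℝ) ≤ (Pi.single k 1 : UpperIndex n → ℝ) l := by
        rw [Pi.single_apply]; split_ifs <;> norm_num
      positivity)
  have h1 : ∑ l, (Pi.single k 1 : UpperIndex n → ℝ) l / √(n : ℝ) = 1 / √(n : ℝ) := by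
    rw [← Finset.sum_div]; simp
  rw [h1] at hsum
  calc |traceCoord B k| ≤ ‖(B * wignerMatrix n (Pi.single k 1)).trace‖ := Complex.abs_re_le_norm _
    _ = ‖∑ i, ∑ j, wignerMatrix n (Pi.single k 1) i j * B j i‖ := by
        rw [trace_mul_comm]; rfl
    _ ≤ ∑ i, ∑ j, (Pi.single k 1 : UpperIndex n → ℝ) ⟨(min i j, max i j), min_le_max⟩ / √(n : ℝ) *
          ‖B‖ := by
        refine norm_sum_le_of_le _ fun i _ => norm_sum_le_of_le _ fun j _ => ?_
        rw [norm_mul]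
        have e : ‖wignerMatrix n (Pi.single k 1) i j‖ =
            (Pi.single k 1 : UpperIndex n → ℝ) ⟨(min i j, max i j), min_le_max⟩ / √(n : ℝ) := by
          simp only [wignerMatrix, of_apply, Complex.norm_real]
          refine Real.norm_of_nonneg ?_
          have : (0 : ℝ) ≤ (Pi.single k 1 : UpperIndex n → ℝ)
            ⟨(min i j, max i j), min_le_max⟩ := by
            rw [Pi.single_apply]; split_ifs <;> norm_num
          positivity
        rw [← e]
        gcongr
        exact norm_apply_le B j i
    _ = (∑ i, ∑ j, (Pi.single k 1 : UpperIndex n → ℝ) ⟨(min i j, max i j), min_le_max⟩ /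
          √(n : ℝ)) * ‖B‖ := by simp_rw [Finset.sum_mul]
    _ ≤ 2 * (1 / √(n : ℝ)) * ‖B‖ := by gcongr
    _ = _ := by ring

/-- The Hessian bound, in dual form. -/
lemma vecNorm_trace_fderiv_le [NeZero n] {c : ℕ → ℂ} (hc : EntireCoeff c)
    (A : Matrix (Fin n) (Fin n) ℂ) (w : UpperIndex n → ℝ) :
    vecNorm (fun k => (fderiv ℂ (powerFun c) A (wignerMatrix n (Pi.single k 1)) *
      wignerMatrix n w).trace.re) ≤
      2 / n * (∑' m : ℕ, (m : ℝ) * ‖c m‖ * ‖A‖ ^ (m - 1)) * vecNorm w := by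
  set q : UpperIndex n → ℝ := fun k => (fderiv ℂ (powerFun c) A
    (wignerMatrix n (Pi.single k 1)) * wignerMatrix n w).trace.re with hq
  set S := ∑' m : ℕ, (m : ℝ) * ‖c m‖ * ‖A‖ ^ (m - 1) with hS
  have hS0 : 0 ≤ S := tsum_nonneg fun m => by positivity
  have hw := vecNorm_nonneg w
  refine vecNorm_le_of_sum_sq_le (by positivity) ?_
  -- The vector q represents a linear form in the direction of differentiation; evaluating that form
  -- at q itself gives its squared norm.
  have e : ∑ k, q k * q k =
      (fderiv ℂ (powerFun c) A (wignerMatrix n q) * wignerMatrix n w).trace.re := by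
    rw [wignerMatrix_eq_sum q, map_sum, Finset.sum_mul, trace_sum, Complex.re_sum]
    refine Finset.sum_congr rfl fun k _ => ?_
    rw [← Complex.coe_smul, map_smul, smul_mul_assoc, trace_smul, Complex.coe_smul, Complex.smul_re,
      smul_eq_mul]
  rw [e]
  calc _ ≤ ‖(fderiv ℂ (powerFun c) A (wignerMatrix n q) * wignerMatrix n w).trace‖ :=
        Complex.re_le_norm _
    _ ≤ S * (hsNorm (wignerMatrix n q) * hsNorm (wignerMatrix n w)) :=
        norm_trace_fderiv_powerFun_mul_le hc _ _ _
    _ ≤ S * ((√(2 / n) * vecNorm q) * (√(2 / n) * vecNorm w)) := by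
        have := hsNorm_nonneg (wignerMatrix n w)
        have := vecNorm_nonneg q
        gcongr <;> exact hsNorm_wignerMatrix_le _
    _ = S * ((√(2 / n) * √(2 / n)) * vecNorm q * vecNorm w) := by ring
    _ = _ := by rw [Real.mul_self_sqrt (by positivity)]; ring

end Wigner

end MatrixBounds

/-! ### Gradient and Hessian of the linear statistic -/

section LinearStatistic

open Matrix
open scoped Matrix.Norms.L2Operator

variable {n : ℕ}

lemma f₁_eq {f : ℂ → ℂ} (hf : Differentiable ℂ f) {r : ℝ} (hr : 0 ≤ r) :
    f₁ f r = ∑' m, ‖derivCoeff (coeff f) m‖ * r ^ m :=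
  ((entireCoeff_coeff hf).hasSum_nat_mul hr).tsum_eq

lemma hasSum_f₂ {f : ℂ → ℂ} (hf : Differentiable ℂ f) {r : ℝ} (hr : 0 ≤ r) :
    HasSum (fun m : ℕ => (m : ℝ) * ((m : ℝ) - 1) * ‖coeff f m‖ * r ^ (m - 2))
      (∑' m : ℕ, (m : ℝ) * ‖derivCoeff (coeff f) m‖ * r ^ (m - 1)) := by
  have h := ((entireCoeff_coeff hf).derivCoeff.hasSum_nat_mul hr).summable.hasSum
  rw [← hasSum_nat_add_iff' 1]
  simp only [Finset.sum_range_one, Nat.cast_zero, zero_mul, sub_zero]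
  refine h.congr_fun fun m => ?_
  rw [norm_derivCoeff, show m + 1 - 2 = m - 1 by omega]
  push_cast; ring

lemma f₂_eq {f : ℂ → ℂ} (hf : Differentiable ℂ f) {r : ℝ} (hr : 0 ≤ r) :
    f₂ f r = ∑' m : ℕ, (m : ℝ) * ‖derivCoeff (coeff f) m‖ * r ^ (m - 1) :=
  (hasSum_f₂ hf hr).tsum_eq

lemma f₁_nonneg {f : ℂ → ℂ} {r : ℝ} (hr : 0 ≤ r) : 0 ≤ f₁ f r :=
  tsum_nonneg fun m => by positivity

lemma f₂_nonneg {f : ℂ → ℂ} (hf : Differentiable ℂ f) {r : ℝ} (hr : 0 ≤ r) : 0 ≤ f₂ f r := by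
  rw [f₂_eq hf hr]
  exact tsum_nonneg fun m => by positivity

/-- If `f₂` vanishes at `r`, then `f₁` takes its value at the origin there. -/
lemma f₁_eq_of_f₂_eq_zero {f : ℂ → ℂ} (hf : Differentiable ℂ f) {r : ℝ} (hr : 0 ≤ r)
    (h : f₂ f r = 0) : f₁ f r = ‖derivCoeff (coeff f) 0‖ := by
  rw [f₂_eq hf hr] at h
  have hs := ((entireCoeff_coeff hf).derivCoeff.hasSum_nat_mul hr).summable
  have h0 := (hasSum_zero_iff_of_nonneg (fun m => by positivity)).1 (h ▸ hs.hasSum)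
  rw [f₁_eq hf hr, tsum_eq_single 0]
  · simp
  · intro m hm
    have := congrFun h0 m
    simp only [Pi.zero_apply, mul_eq_zero, Nat.cast_eq_zero, hm, false_or] at this
    rcases this with h1 | h1
    · rw [h1, zero_mul]
    · rw [show m = (m - 1) + 1 by omega, pow_succ, h1, zero_mul, mul_zero]

lemma norm_powerFun_derivCoeff_le [NeZero n] {f : ℂ → ℂ} (hf : Differentiable ℂ f)
    (A : Matrix (Fin n) (Fin n) ℂ) : ‖powerFun (derivCoeff (coeff f)) A‖ ≤ f₁ f ‖A‖ := by
  rw [f₁_eq hf (norm_nonneg A)]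
  exact (entireCoeff_coeff hf).derivCoeff.norm_powerFun_le A

lemma vecNorm_add_le {ι : Type*} [Fintype ι] (x y : ι → ℝ) :
    vecNorm (fun k => x k + y k) ≤ vecNorm x + vecNorm y := by
  have h := norm_add_le (WithLp.toLp 2 x : EuclideanSpace ℝ ι) (WithLp.toLp 2 y)
  simpa [EuclideanSpace.norm_eq, vecNorm] using h

lemma vecNorm_mul_le {ι : Type*} [Fintype ι] {a x : ι → ℝ} {C : ℝ} (hC : 0 ≤ C)
    (ha : ∀ k, |a k| ≤ C) : vecNorm (fun k => a k * x k) ≤ C * vecNorm x := by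
  refine abs_le_of_sq_le_sq' ?_ (mul_nonneg hC (vecNorm_nonneg _)) |>.2
  rw [mul_pow, vecNorm_sq, vecNorm_sq, Finset.mul_sum]
  refine Finset.sum_le_sum fun k _ => ?_
  rw [mul_pow]
  exact mul_le_mul_of_nonneg_right (sq_le_sq' (abs_le.1 (ha k)).1 (abs_le.1 (ha k)).2) (sq_nonneg _)

variable {u : UpperIndex n → ℝ → ℝ}

/-- Coordinatewise application of a family of functions. -/
def coordMap {ι : Type*} (u : ι → ℝ → ℝ) (x : ι → ℝ) : ι → ℝ := fun i => u i (x i)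

lemma contDiff_coordMap {ι : Type*} [Fintype ι] {u : ι → ℝ → ℝ} {N : WithTop ℕ∞}
    (hu : ∀ i, ContDiff ℝ N (u i)) : ContDiff ℝ N (coordMap u) :=
  contDiff_pi.2 fun i => (hu i).comp (contDiff_apply ℝ ℝ i)

lemma hasFDerivAt_comp_apply {ι : Type*} [Fintype ι] {v : ℝ → ℝ} {v' : ℝ} {i : ι} {x : ι → ℝ}
    (hv : HasDerivAt v v' (x i)) : HasFDerivAt (fun x : ι → ℝ => v (x i))
      (v' • ContinuousLinearMap.proj (R := ℝ) (φ := fun _ : ι => ℝ) i) x :=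
  HasDerivAt.comp_hasFDerivAt (f := fun x : ι → ℝ => x i) x hv
    (ContinuousLinearMap.proj (R := ℝ) (φ := fun _ : ι => ℝ) i).hasFDerivAt

lemma hasFDerivAt_coordMap {ι : Type*} [Fintype ι] {u : ι → ℝ → ℝ}
    (hu : ∀ i, Differentiable ℝ (u i)) (x : ι → ℝ) :
    HasFDerivAt (coordMap u)
      (ContinuousLinearMap.pi fun i =>
        deriv (u i) (x i) • ContinuousLinearMap.proj (R := ℝ) (φ := fun _ : ι => ℝ) i) x :=
  hasFDerivAt_pi.2 fun i => hasFDerivAt_comp_apply (hu i (x i)).hasDerivAt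

/-- The linear statistic as a function of gaussian variables. -/
def gaussStat (f : ℂ → ℂ) (u : UpperIndex n → ℝ → ℝ) (x : UpperIndex n → ℝ) : ℝ :=
  linStat f (wignerMatrix n (coordMap u x))

/-- The partial derivatives of `gaussStat`. -/
def gaussGrad (f : ℂ → ℂ) (u : UpperIndex n → ℝ → ℝ) (i : UpperIndex n)
    (x : UpperIndex n → ℝ) : ℝ :=
  deriv (u i) (x i) *
    traceCoord (powerFun (derivCoeff (coeff f)) (wignerMatrix n (coordMap u x))) i

/-- `B ↦ Re Tr(B W)` as a continuous real linear form. -/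
def reTraceMul (W : Matrix (Fin n) (Fin n) ℂ) : Matrix (Fin n) (Fin n) ℂ →L[ℝ] ℝ :=
  LinearMap.toContinuousLinearMap
    { toFun := fun B => (B * W).trace.re
      map_add' := fun x y => by simp [add_mul]
      map_smul' := fun r x => by simp [trace_smul] }

@[simp] lemma reTraceMul_apply (W B : Matrix (Fin n) (Fin n) ℂ) :
    reTraceMul W B = (B * W).trace.re := rfl

lemma hasFDerivAt_powerFun_coordMap [NeZero n] {c : ℕ → ℂ} (hc : EntireCoeff c)
    (hu : ∀ i, Differentiable ℝ (u i)) (x : UpperIndex n → ℝ) :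
    HasFDerivAt (fun x => powerFun c (wignerMatrix n (coordMap u x)))
      (((fderiv ℂ (powerFun c) (wignerMatrix n (coordMap u x))).restrictScalars ℝ).comp
        ((wignerCLM n).comp (ContinuousLinearMap.pi fun i =>
          deriv (u i) (x i) •
            ContinuousLinearMap.proj (R := ℝ) (φ := fun _ : UpperIndex n => ℝ) i))) x := by
  have h1 : HasFDerivAt (powerFun c) (fderiv ℂ (powerFun c) (wignerMatrix n (coordMap u x)))
      (wignerMatrix n (coordMap u x)) := by
    rw [(hc.hasFDerivAt_powerFun _).fderiv]; exact hc.hasFDerivAt_powerFun _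
  exact (h1.restrictScalars ℝ).comp x
    ((wignerCLM n).hasFDerivAt.comp x (hasFDerivAt_coordMap hu x))

lemma contDiff_powerFun_coordMap [NeZero n] {c : ℕ → ℂ} (hc : EntireCoeff c) {N : WithTop ℕ∞}
    (hu : ∀ i, ContDiff ℝ N (u i)) :
    ContDiff ℝ N fun x => powerFun c (wignerMatrix n (coordMap u x)) :=
  ((hc.contDiff_powerFun N).restrict_scalars ℝ).comp
    ((wignerCLM n).contDiff.comp (contDiff_coordMap hu))

lemma hasFDerivAt_gaussStat [NeZero n] {f : ℂ → ℂ} (hf : Differentiable ℂ f)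
    (hu : ∀ i, Differentiable ℝ (u i)) (x : UpperIndex n → ℝ) :
    HasFDerivAt (gaussStat f u)
      (∑ i, gaussGrad f u i x •
        ContinuousLinearMap.proj (R := ℝ) (φ := fun _ : UpperIndex n => ℝ) i) x := by
  have hc := entireCoeff_coeff hf
  have h := (reTraceMul (1 : Matrix (Fin n) (Fin n) ℂ)).hasFDerivAt.comp x
    (hasFDerivAt_powerFun_coordMap hc hu x)
  have e : (reTraceMul (1 : Matrix (Fin n) (Fin n) ℂ)) ∘
      (fun x => powerFun (coeff f) (wignerMatrix n (coordMap u x))) = gaussStat f u := by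
    ext x
    simp only [Function.comp_apply, reTraceMul_apply, mul_one]
    -- The topology of the operator norm is definitionally the entrywise one, so the two infinite
    -- sums coincide.
    rfl
  rw [e] at h
  refine h.congr_fderiv ?_
  ext v
  simp only [ContinuousLinearMap.comp_apply, reTraceMul_apply, mul_one,
    ContinuousLinearMap.coe_restrictScalars', wignerCLM_apply, _root_.sum_apply, _root_.smul_apply,
    ContinuousLinearMap.proj_apply, smul_eq_mul]
  rw [trace_fderiv_powerFun hc, re_trace_mul_wignerMatrix]
  refine Finset.sum_congr rfl fun i _ => ?_
  simp [gaussGrad]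
  ring

lemma contDiff_deriv_of_two {v : ℝ → ℝ} (hv : ContDiff ℝ 2 v) : ContDiff ℝ 1 (deriv v) :=
  ((contDiff_succ_iff_deriv (n := 1)).1 (by exact_mod_cast hv)).2.2

lemma contDiff_gaussGrad [NeZero n] {f : ℂ → ℂ} (hf : Differentiable ℂ f)
    (hu : ∀ i, ContDiff ℝ 2 (u i)) (i : UpperIndex n) : ContDiff ℝ 1 (gaussGrad f u i) := by
  have h1 : ContDiff ℝ 1 fun x : UpperIndex n → ℝ => deriv (u i) (x i) :=
    (contDiff_deriv_of_two (hu i)).comp (contDiff_apply ℝ ℝ i)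
  have h2 := (reTraceMul (wignerMatrix n (Pi.single i 1))).contDiff.comp
    (contDiff_powerFun_coordMap (entireCoeff_coeff hf).derivCoeff (N := 1)
      fun i => (hu i).of_le (by norm_num))
  exact h1.mul h2

lemma fderiv_gaussGrad [NeZero n] {f : ℂ → ℂ} (hf : Differentiable ℂ f)
    (hu : ∀ i, ContDiff ℝ 2 (u i)) (i k : UpperIndex n) (x : UpperIndex n → ℝ) :
    fderiv ℝ (gaussGrad f u i) x (Pi.single k 1) =
      (if i = k then deriv (deriv (u i)) (x i) *
        traceCoord (powerFun (derivCoeff (coeff f)) (wignerMatrix n (coordMap u x))) i else 0) +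
      deriv (u i) (x i) * (deriv (u k) (x k) *
        (fderiv ℂ (powerFun (derivCoeff (coeff f))) (wignerMatrix n (coordMap u x))
          (wignerMatrix n (Pi.single k 1)) * wignerMatrix n (Pi.single i 1)).trace.re) := by
  have hc := (entireCoeff_coeff hf).derivCoeff
  have hud : ∀ i, Differentiable ℝ (u i) := fun i => (hu i).differentiable (by norm_num)
  have h1 : HasFDerivAt (fun x : UpperIndex n → ℝ => deriv (u i) (x i))
      (deriv (deriv (u i)) (x i) •
        ContinuousLinearMap.proj (R := ℝ) (φ := fun _ : UpperIndex n => ℝ) i) x :=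
    hasFDerivAt_comp_apply
      ((contDiff_deriv_of_two (hu i)).differentiable one_ne_zero (x i)).hasDerivAt
  have h2 := (reTraceMul (wignerMatrix n (Pi.single i 1))).hasFDerivAt.comp x
    (hasFDerivAt_powerFun_coordMap hc hud x)
  have h3 : HasFDerivAt (gaussGrad f u i) _ x := h1.mul h2
  rw [h3.fderiv]
  have e : (fun j => deriv (u j) (x j) * (Pi.single k 1 : UpperIndex n → ℝ) j) =
      deriv (u k) (x k) • Pi.single k 1 := by
    ext j
    by_cases hj : j = k
    · subst hj; simp
    · simp [hj]
  have e' : (ContinuousLinearMap.pi fun i =>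
      deriv (u i) (x i) • ContinuousLinearMap.proj (R := ℝ) (φ := fun _ : UpperIndex n => ℝ) i)
      (Pi.single k 1) = deriv (u k) (x k) • Pi.single k 1 := by
    rw [← e]; ext j; simp
  simp only [_root_.add_apply, _root_.smul_apply, ContinuousLinearMap.comp_apply, e',
    ContinuousLinearMap.coe_restrictScalars', wignerCLM_apply, wignerMatrix_smul, reTraceMul_apply,
    ContinuousLinearMap.proj_apply, smul_eq_mul]
  rw [← Complex.coe_smul, map_smul, smul_mul_assoc, trace_smul, Complex.coe_smul, Complex.smul_re,
    add_comm]
  congr 1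
  by_cases hik : i = k
  · subst hik; simp [traceCoord]; ring
  · simp [hik]

variable {c₁ c₂ : ℝ}

lemma vecNorm_gaussGrad_le [NeZero n] {f : ℂ → ℂ} (hf : Differentiable ℂ f) (hc₁ : 0 ≤ c₁)
    (hu1 : ∀ i x, |deriv (u i) x| ≤ c₁) (x : UpperIndex n → ℝ) :
    vecNorm (fun i => gaussGrad f u i x) ≤
      c₁ * (√2 * f₁ f (specRadius (wignerMatrix n (coordMap u x)))) := by
  refine (vecNorm_mul_le hc₁ fun i => hu1 i (x i)).trans ?_
  gcongr
  refine (vecNorm_traceCoord_le _).trans ?_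
  rw [specRadius_wignerMatrix]
  gcongr
  exact norm_powerFun_derivCoeff_le hf _

/-- At x the Hessian is diag(u''T) + J H J with J = diag(u'). The diagonal part is a multiplier
bounded coordinatewise. In the other part each J costs c₁ and H costs (2/n) f₂; the gradient at the
second point supplies the remaining √2 c₁ f₁. -/
lemma hessGradNorm_gaussGrad_le [NeZero n] {f : ℂ → ℂ} (hf : Differentiable ℂ f) (hc₁ : 0 ≤ c₁)
    (hc₂ : 0 ≤ c₂) (hu : ∀ i, ContDiff ℝ 2 (u i)) (hu1 : ∀ i x, |deriv (u i) x| ≤ c₁)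
    (hu2 : ∀ i x, |deriv (deriv (u i)) x| ≤ c₂)
    (z : (UpperIndex n → ℝ) × (UpperIndex n → ℝ)) :
    hessGradNorm (gaussGrad f u) z ≤
      (2 * √2 * (c₁ * c₂) / √(n : ℝ)) *
        (f₁ f (specRadius (wignerMatrix n (coordMap u z.1))) *
          f₁ f (specRadius (wignerMatrix n (coordMap u z.2)))) +
      (2 * √2 * c₁ ^ 3 / n) *
        (f₂ f (specRadius (wignerMatrix n (coordMap u z.1))) *
          f₁ f (specRadius (wignerMatrix n (coordMap u z.2)))) := by
  obtain ⟨x, y⟩ := z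
  have hc := (entireCoeff_coeff hf).derivCoeff
  set A := wignerMatrix n (coordMap u x) with hA
  set v : UpperIndex n → ℝ := fun i => gaussGrad f u i y with hv
  set T := traceCoord (powerFun (derivCoeff (coeff f)) A) with hT
  set w : UpperIndex n → ℝ := fun i => deriv (u i) (x i) * v i with hw
  set q : UpperIndex n → ℝ := fun k => (fderiv ℂ (powerFun (derivCoeff (coeff f))) A
    (wignerMatrix n (Pi.single k 1)) * wignerMatrix n w).trace.re with hq
  have hF1 : 0 ≤ f₁ f (specRadius A) := f₁_nonneg (by rw [hA, specRadius_wignerMatrix]; positivity)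
  have hF2 : 0 ≤ f₂ f (specRadius A) :=
    f₂_nonneg hf (by rw [hA, specRadius_wignerMatrix]; positivity)
  have hvn := vecNorm_gaussGrad_le hf hc₁ hu1 y
  have hwn : vecNorm w ≤ c₁ * vecNorm v := vecNorm_mul_le hc₁ fun i => hu1 i (x i)
  have hqn : vecNorm q ≤ 2 / n * f₂ f (specRadius A) * vecNorm w := by
    rw [hA, specRadius_wignerMatrix, f₂_eq hf (norm_nonneg _)]
    exact vecNorm_trace_fderiv_le hc A w
  have key : ∀ k, ∑ i, fderiv ℝ (gaussGrad f u i) x (Pi.single k 1) * gaussGrad f u i y =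
      deriv (deriv (u k)) (x k) * T k * v k + deriv (u k) (x k) * q k := fun k => by
    have eq1 : q k = ∑ i, w i * (fderiv ℂ (powerFun (derivCoeff (coeff f))) A
        (wignerMatrix n (Pi.single k 1)) * wignerMatrix n (Pi.single i 1)).trace.re := by
      rw [hq]
      exact re_trace_mul_wignerMatrix _ w
    simp_rw [fderiv_gaussGrad hf hu, add_mul, Finset.sum_add_distrib, ite_mul, zero_mul]
    rw [Finset.sum_ite_eq' Finset.univ k, if_pos (Finset.mem_univ k), eq1, Finset.mul_sum]
    congr 1
    refine Finset.sum_congr rfl fun i _ => ?_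
    simp only [hw, hv]
    ring
  have hTk : ∀ k, |deriv (deriv (u k)) (x k) * T k| ≤ c₂ * (2 / √(n : ℝ) * f₁ f (specRadius A)) :=
    fun k => by
      rw [abs_mul]
      refine mul_le_mul (hu2 _ _) ?_ (abs_nonneg _) hc₂
      refine (abs_traceCoord_le _ k).trans ?_
      rw [hA, specRadius_wignerMatrix]
      gcongr
      exact norm_powerFun_derivCoeff_le hf _
  calc hessGradNorm (gaussGrad f u) (x, y)
      = vecNorm fun k => deriv (deriv (u k)) (x k) * T k * v k + deriv (u k) (x k) * q k := by
        simp only [hessGradNorm, vecNorm, key]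
    _ ≤ c₂ * (2 / √(n : ℝ) * f₁ f (specRadius A)) * vecNorm v + c₁ * vecNorm q :=
        (vecNorm_add_le _ _).trans (add_le_add (vecNorm_mul_le (by positivity) hTk)
          (vecNorm_mul_le hc₁ fun k => hu1 k (x k)))
    _ ≤ c₂ * (2 / √(n : ℝ) * f₁ f (specRadius A)) * vecNorm v +
        c₁ * (2 / n * f₂ f (specRadius A) * (c₁ * vecNorm v)) := by
        gcongr
        refine hqn.trans ?_
        gcongr
    _ ≤ c₂ * (2 / √(n : ℝ) * f₁ f (specRadius A)) *
          (c₁ * (√2 * f₁ f (specRadius (wignerMatrix n (coordMap u y))))) +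
        c₁ * (2 / n * f₂ f (specRadius A) *
          (c₁ * (c₁ * (√2 * f₁ f (specRadius (wignerMatrix n (coordMap u y))))))) := by
        gcongr
    _ = _ := by ring

end LinearStatistic

/-! ### Moment bounds, infinite moments and constants -/

section Main

open scoped Matrix.Norms.L2Operator

lemma lintegral_mul_le_sqrt {α : Type*} [MeasurableSpace α] (μ : Measure α) {f g : α → ℝ≥0∞}
    (hf : Measurable f) (hg : Measurable g) :
    ∫⁻ x, f x * g x ∂μ ≤
      (∫⁻ x, f x ^ 2 ∂μ) ^ (1 / 2 : ℝ) * (∫⁻ x, g x ^ 2 ∂μ) ^ (1 / 2 : ℝ) := by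
  have h : (2 : ℝ).HolderConjugate 2 := Real.HolderConjugate.two_two
  have := ENNReal.lintegral_mul_le_Lp_mul_Lq μ h hf.aemeasurable hg.aemeasurable
  simpa using this

lemma lintegral_sq_le {α : Type*} [MeasurableSpace α] (μ : Measure α) [IsProbabilityMeasure μ]
    {f : α → ℝ≥0∞} (hf : Measurable f) :
    (∫⁻ x, f x ^ 2 ∂μ) ^ (1 / 2 : ℝ) ≤ (∫⁻ x, f x ^ 4 ∂μ) ^ (1 / 4 : ℝ) := by
  have h := lintegral_mul_le_sqrt μ (hf.pow_const 2) (measurable_const (a := (1 : ℝ≥0∞)))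
  simp only [mul_one, one_pow, lintegral_const, measure_univ, ENNReal.one_rpow, ← pow_mul] at h
  calc (∫⁻ x, f x ^ 2 ∂μ) ^ (1 / 2 : ℝ)
      ≤ ((∫⁻ x, f x ^ 4 ∂μ) ^ (1 / 2 : ℝ)) ^ (1 / 2 : ℝ) := by gcongr
    _ = _ := by rw [← ENNReal.rpow_mul]; norm_num

/-- Hölder's inequality for a pair with prescribed marginals. -/
lemma lintegral_mul_le_of_marginals {α : Type*} [MeasurableSpace α] {μ : Measure α}
    [IsProbabilityMeasure μ] {ρ : Measure (α × α)} (h1 : MeasurePreserving Prod.fst ρ μ)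
    (h2 : MeasurePreserving Prod.snd ρ μ) {f g : α → ℝ≥0∞} (hf : Measurable f)
    (hg : Measurable g) :
    ∫⁻ z, f z.1 * g z.2 ∂ρ ≤
      (∫⁻ x, f x ^ 4 ∂μ) ^ (1 / 4 : ℝ) * (∫⁻ x, g x ^ 4 ∂μ) ^ (1 / 4 : ℝ) := by
  refine (lintegral_mul_le_sqrt ρ (hf.comp measurable_fst) (hg.comp measurable_snd)).trans ?_
  have e1 : ∫⁻ z, (f ∘ Prod.fst) z ^ 2 ∂ρ = ∫⁻ x, f x ^ 2 ∂μ := h1.lintegral_comp (hf.pow_const 2)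
  have e2 : ∫⁻ z, (g ∘ Prod.snd) z ^ 2 ∂ρ = ∫⁻ x, g x ^ 2 ∂μ := h2.lintegral_comp (hg.pow_const 2)
  rw [e1, e2]
  gcongr <;> exact lintegral_sq_le μ ‹_›

lemma measurable_of_hasSum {α : Type*} [MeasurableSpace α] {F : ℕ → α → ℝ} {g : α → ℝ}
    (hF : ∀ m, Measurable (F m)) (h : ∀ x, HasSum (fun m => F m x) (g x)) : Measurable g := by
  refine measurable_of_tendsto_metrizable (f := fun N x => ∑ m ∈ Finset.range N, F m x)
    (fun N => Finset.measurable_fun_sum _ fun m _ => hF m) ?_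
  exact tendsto_pi_nhds.2 fun x => (h x).tendsto_sum_nat

variable {n : ℕ}

lemma continuous_wignerMatrix : Continuous (wignerMatrix n) := (wignerCLM n).continuous

lemma measurable_f₁_specRadius {f : ℂ → ℂ} (hf : Differentiable ℂ f) :
    Measurable fun x : UpperIndex n → ℝ => f₁ f (specRadius (wignerMatrix n x)) := by
  have hm : Measurable fun x : UpperIndex n → ℝ => ‖wignerMatrix n x‖ :=
    continuous_wignerMatrix.norm.measurable
  simp only [specRadius_wignerMatrix, f₁_eq hf (norm_nonneg _)]
  exact measurable_of_hasSum (fun m => (hm.pow_const m).const_mul _)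
    fun x => ((entireCoeff_coeff hf).derivCoeff _ (norm_nonneg _)).hasSum

lemma measurable_f₂_specRadius {f : ℂ → ℂ} (hf : Differentiable ℂ f) :
    Measurable fun x : UpperIndex n → ℝ => f₂ f (specRadius (wignerMatrix n x)) := by
  have hm : Measurable fun x : UpperIndex n → ℝ => ‖wignerMatrix n x‖ :=
    continuous_wignerMatrix.norm.measurable
  simp only [specRadius_wignerMatrix, f₂_eq hf (norm_nonneg _)]
  exact measurable_of_hasSum (fun m => (hm.pow_const (m - 1)).const_mul _)
    fun x => ((entireCoeff_coeff hf).derivCoeff.hasSum_nat_mul (norm_nonneg _)).summable.hasSum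

lemma continuous_linStat_wignerMatrix [NeZero n] {f : ℂ → ℂ} (hf : Differentiable ℂ f) :
    Continuous fun x : UpperIndex n → ℝ => linStat f (wignerMatrix n x) := by
  have h := (((entireCoeff_coeff hf).contDiff_powerFun 0 :
    ContDiff ℂ 0 (powerFun (coeff f) : Matrix (Fin n) (Fin n) ℂ → _))).continuous
  exact Complex.continuous_re.comp
    (Continuous.matrix_trace (h.comp continuous_wignerMatrix))

lemma tvDist_self (μ : Measure ℝ) : tvDist μ μ = 0 := by simp [tvDist]

variable {u : UpperIndex n → ℝ → ℝ} {c₁ c₂ : ℝ} {f : ℂ → ℂ}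

/-- The bound of the theorem in terms of the gaussian variables. -/
theorem tvDist_gaussStat_le [NeZero n] (hf : Differentiable ℂ f) (hc₁ : 0 ≤ c₁) (hc₂ : 0 ≤ c₂)
    (hu : ∀ i, ContDiff ℝ 2 (u i)) (hu1 : ∀ i x, |deriv (u i) x| ≤ c₁)
    (hu2 : ∀ i x, |deriv (deriv (u i)) x| ≤ c₂) {a b K : ℝ≥0∞}
    (ha : a = (∫⁻ x, ENNReal.ofReal (f₁ f (specRadius (wignerMatrix n (coordMap u x)))) ^ 4
      ∂stdGaussianPi (UpperIndex n)) ^ (1 / 4 : ℝ))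
    (hb : b = (∫⁻ x, ENNReal.ofReal (f₂ f (specRadius (wignerMatrix n (coordMap u x)))) ^ 4
      ∂stdGaussianPi (UpperIndex n)) ^ (1 / 4 : ℝ))
    (hK : K = ENNReal.ofReal (2 * √2 * (c₁ * c₂) / √(n : ℝ)) * (a * a) +
      ENNReal.ofReal (2 * √2 * c₁ ^ 3 / n) * (b * a))
    (hW2 : MemLp (gaussStat f u) 2 (stdGaussianPi (UpperIndex n)))
    (hv : 0 < variance (gaussStat f u) (stdGaussianPi (UpperIndex n))) :
    tvDist ((stdGaussianPi (UpperIndex n)).map (gaussStat f u))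
      (gaussianReal (∫ x, gaussStat f u x ∂stdGaussianPi (UpperIndex n))
        (variance (gaussStat f u) (stdGaussianPi (UpperIndex n))).toNNReal) ≤
      ENNReal.ofReal (2 * Real.pi / variance (gaussStat f u) (stdGaussianPi (UpperIndex n))) *
        K := by
  set γ := stdGaussianPi (UpperIndex n) with hγ
  set v := variance (gaussStat f u) γ with hvdef
  have hn : (0 : ℝ) < n := by exact_mod_cast Nat.pos_of_neZero n
  have hcm : Continuous (coordMap u) := (contDiff_coordMap hu).continuous
  set F₁ : (UpperIndex n → ℝ) → ℝ := fun x =>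
    f₁ f (specRadius (wignerMatrix n (coordMap u x))) with hF₁
  set F₂ : (UpperIndex n → ℝ) → ℝ := fun x =>
    f₂ f (specRadius (wignerMatrix n (coordMap u x))) with hF₂
  have hF₁m : Measurable F₁ := (measurable_f₁_specRadius hf).comp hcm.measurable
  have hF₂m : Measurable F₂ := (measurable_f₂_specRadius hf).comp hcm.measurable
  have hspec : ∀ x, 0 ≤ specRadius (wignerMatrix n (coordMap u x)) := fun x => by
    rw [specRadius_wignerMatrix]; positivity
  have hF₁0 : ∀ x, 0 ≤ F₁ x := fun x => f₁_nonneg (hspec x)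
  have hF₂0 : ∀ x, 0 ≤ F₂ x := fun x => f₂_nonneg hf (hspec x)
  by_cases hKtop : K = ∞
  · rw [hKtop, ENNReal.mul_top]
    · exact le_top
    · simp only [ne_eq, ENNReal.ofReal_eq_zero, not_le]; positivity
  -- If c₁ = 0 every u_i is constant and the variance vanishes. Positivity makes the coefficient of
  -- ba nonzero below.
  have hc₁pos : 0 < c₁ := by
    refine lt_of_le_of_ne hc₁ fun h0 => hv.ne' ?_
    have hconst : ∀ x, gaussStat f u x = gaussStat f u 0 := fun x => by
      have : coordMap u x = coordMap u 0 := by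
        ext i
        refine is_const_of_deriv_eq_zero ((hu i).differentiable (by norm_num)) (fun t => ?_) _ _
        have := hu1 i t
        rw [← h0] at this
        exact abs_nonpos_iff.1 this
      simp only [gaussStat, this]
    have : gaussStat f u = fun _ => gaussStat f u 0 := funext hconst
    rw [hvdef, this]
    simp [variance_eq_integral aemeasurable_const]
  -- Finite K does not exclude a = ∞ outright, since 0 · ∞ = 0. But then b = 0, so f₂(λ) = 0 almost
  -- surely, f₁(λ) is almost surely the constant |b₁|, and a is finite after all. Finiteness of a is
  -- what makes the gradient square integrable.
  have hatop : a ≠ ∞ := by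
    intro hat
    have hβ : ENNReal.ofReal (2 * √2 * c₁ ^ 3 / n) ≠ 0 := by
      simp only [ne_eq, ENNReal.ofReal_eq_zero, not_le]; positivity
    have hb0 : b = 0 := by
      by_contra hb0
      refine hKtop ?_
      rw [hK, hat, ENNReal.mul_top hb0, ENNReal.mul_top hβ, add_top]
    rw [hb0, eq_comm, ENNReal.rpow_eq_zero_iff_of_pos (by norm_num),
      lintegral_eq_zero_iff (hF₂m.ennreal_ofReal.pow_const 4)] at hb
    have hae : ∀ᵐ x ∂γ, ENNReal.ofReal (F₁ x) ^ 4 =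
        ENNReal.ofReal ‖derivCoeff (coeff f) 0‖ ^ 4 := by
      filter_upwards [hb] with x hx
      have h2 : F₂ x = 0 := by
        have : ENNReal.ofReal (F₂ x) = 0 := by simpa using hx
        exact le_antisymm (ENNReal.ofReal_eq_zero.1 this) (hF₂0 x)
      simp only [hF₁]
      rw [f₁_eq_of_f₂_eq_zero hf (hspec x) h2]
    rw [lintegral_congr_ae hae, lintegral_const, measure_univ, mul_one, hat] at ha
    exact ENNReal.rpow_ne_top_of_nonneg (by norm_num)
      (ENNReal.pow_ne_top ENNReal.ofReal_ne_top) ha.symm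
  have hF₁L : MemLp F₁ 2 γ := by
    have h4 : MemLp F₁ 4 γ := by
      refine ⟨hF₁m.aestronglyMeasurable, ?_⟩
      rw [eLpNorm_eq_lintegral_rpow_enorm_toReal (by norm_num) (by norm_num)]
      refine lt_of_eq_of_lt ?_ (lt_top_iff_ne_top.2 hatop)
      rw [ha]
      simp only [ENNReal.toReal_ofNat]
      congr 1
      refine lintegral_congr fun x => ?_
      rw [Real.enorm_eq_ofReal (hF₁0 x)]
      norm_cast
    exact h4.mono_exponent (by norm_num)
  have hd2 : ∀ i, MemLp (gaussGrad f u i) 2 γ := fun i => by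
    refine (hF₁L.const_mul (c₁ * √2)).mono'
      (contDiff_gaussGrad hf hu i).continuous.aestronglyMeasurable (ae_of_all _ fun x => ?_)
    calc ‖gaussGrad f u i x‖ ≤ vecNorm fun i => gaussGrad f u i x := by
          rw [Real.norm_eq_abs]
          refine Real.abs_le_sqrt ?_
          exact Finset.single_le_sum (f := fun i => gaussGrad f u i x ^ 2)
            (fun i _ => sq_nonneg _) (Finset.mem_univ i)
      _ ≤ c₁ * (√2 * F₁ x) := vecNorm_gaussGrad_le hf hc₁ hu1 x
      _ = c₁ * √2 * F₁ x := by ring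
  have hKρ : ∀ ρ : Measure ((UpperIndex n → ℝ) × (UpperIndex n → ℝ)),
      MeasurePreserving Prod.fst ρ γ → MeasurePreserving Prod.snd ρ γ →
      ∫⁻ z, ENNReal.ofReal (hessGradNorm (gaussGrad f u) z) ∂ρ ≤ K := fun ρ h1 h2 => by
    have m1 := hF₁m.ennreal_ofReal
    have m2 := hF₂m.ennreal_ofReal
    have hpt : ∀ z, ENNReal.ofReal (hessGradNorm (gaussGrad f u) z) ≤
        ENNReal.ofReal (2 * √2 * (c₁ * c₂) / √(n : ℝ)) *
          (ENNReal.ofReal (F₁ z.1) * ENNReal.ofReal (F₁ z.2)) +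
        ENNReal.ofReal (2 * √2 * c₁ ^ 3 / n) *
          (ENNReal.ofReal (F₂ z.1) * ENNReal.ofReal (F₁ z.2)) := fun z => by
      have p1 := hF₁0 z.1
      have p2 := hF₁0 z.2
      have p3 := hF₂0 z.1
      rw [← ENNReal.ofReal_mul p1, ← ENNReal.ofReal_mul p3, ← ENNReal.ofReal_mul (by positivity),
        ← ENNReal.ofReal_mul (by positivity), ← ENNReal.ofReal_add (by positivity) (by positivity)]
      exact ENNReal.ofReal_le_ofReal (hessGradNorm_gaussGrad_le hf hc₁ hc₂ hu hu1 hu2 z)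
    refine (lintegral_mono hpt).trans ?_
    have mm1 : Measurable fun z : (UpperIndex n → ℝ) × (UpperIndex n → ℝ) =>
      ENNReal.ofReal (F₁ z.1) * ENNReal.ofReal (F₁ z.2) :=
        (m1.comp measurable_fst).mul (m1.comp measurable_snd)
    have mm2 : Measurable fun z : (UpperIndex n → ℝ) × (UpperIndex n → ℝ) =>
      ENNReal.ofReal (F₂ z.1) * ENNReal.ofReal (F₁ z.2) :=
        (m2.comp measurable_fst).mul (m1.comp measurable_snd)
    rw [lintegral_add_left (mm1.const_mul _), lintegral_const_mul _ mm1, lintegral_const_mul _ mm2,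
      hK]
    gcongr
    · rw [ha]; exact lintegral_mul_le_of_marginals h1 h2 m1 m1
    · rw [ha, hb]; exact lintegral_mul_le_of_marginals h1 h2 m2 m1
  have main := tvDist_map_gaussianReal_le
    (hasFDerivAt_gaussStat hf fun i => (hu i).differentiable (by norm_num))
    (contDiff_gaussGrad hf hu) hW2 hd2 hKtop hKρ hv
  refine main.trans (le_of_eq ?_)
  rw [ENNReal.ofReal_mul (by positivity), ENNReal.ofReal_toReal hKtop]

/-- Comparison of the constants. -/
lemma ofReal_mul_le_bound (hn : 1 ≤ n) (hc₁ : 0 ≤ c₁) (hc₂ : 0 ≤ c₂) {v : ℝ} (hv : 0 < v)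
    (a b : ℝ≥0∞) :
    ENNReal.ofReal (2 * Real.pi / v) * (ENNReal.ofReal (2 * √2 * (c₁ * c₂) / √(n : ℝ)) * (a * a) +
      ENNReal.ofReal (2 * √2 * c₁ ^ 3 / n) * (b * a)) ≤
    ENNReal.ofReal (2 * √5 / v) *
        (ENNReal.ofReal (4 * c₁ * c₂) * a ^ 2 / ENNReal.ofReal √(n : ℝ) +
          ENNReal.ofReal (8 * c₁ ^ 3) * a * b / (n : ℝ≥0∞)) := by
  have hn0 : (0 : ℝ) < n := by exact_mod_cast hn
  -- Squared, this is π² ≤ 10. It is nearly sharp and determines the first term; the second term has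
  -- a further factor 2 to spare.
  have hpi : Real.pi * √2 ≤ 2 * √5 := by
    have h1 : Real.pi < 3.15 := Real.pi_lt_d2
    have h2 : √2 ^ 2 = 2 := Real.sq_sqrt (by norm_num)
    have h5 : √5 ^ 2 = 5 := Real.sq_sqrt (by norm_num)
    refine abs_le_of_sq_le_sq' ?_ (by positivity) |>.2
    rw [mul_pow, mul_pow, h2, h5]
    nlinarith [Real.pi_pos, Real.pi_lt_d4]
  have e1 : ENNReal.ofReal (4 * c₁ * c₂) * a ^ 2 / ENNReal.ofReal √(n : ℝ) =
      ENNReal.ofReal (4 * c₁ * c₂ / √(n : ℝ)) * (a * a) := by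
    rw [ENNReal.ofReal_div_of_pos (Real.sqrt_pos.2 hn0), div_eq_mul_inv, div_eq_mul_inv]; ring
  have e2 : ENNReal.ofReal (8 * c₁ ^ 3) * a * b / (n : ℝ≥0∞) =
      ENNReal.ofReal (8 * c₁ ^ 3 / n) * (b * a) := by
    rw [ENNReal.ofReal_div_of_pos hn0, div_eq_mul_inv, div_eq_mul_inv, ENNReal.ofReal_natCast]; ring
  have hmul : ∀ (s t : ℝ) (x : ℝ≥0∞), 0 ≤ s →
      ENNReal.ofReal s * (ENNReal.ofReal t * x) = ENNReal.ofReal (s * t) * x := fun s t x hs => by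
    rw [← mul_assoc, ENNReal.ofReal_mul hs]
  rw [e1, e2, mul_add, mul_add, hmul _ _ _ (by positivity), hmul _ _ _ (by positivity),
    hmul _ _ _ (by positivity), hmul _ _ _ (by positivity)]
  gcongr ENNReal.ofReal ?_ * _ + ENNReal.ofReal ?_ * _
  · calc 2 * Real.pi / v * (2 * √2 * (c₁ * c₂) / √(n : ℝ))
        = 4 * (Real.pi * √2) * (c₁ * c₂ / (v * √(n : ℝ))) := by ring
      _ ≤ 4 * (2 * √5) * (c₁ * c₂ / (v * √(n : ℝ))) := by gcongr
      _ = _ := by ring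
  · calc 2 * Real.pi / v * (2 * √2 * c₁ ^ 3 / n)
        = 4 * (Real.pi * √2) * (c₁ ^ 3 / (v * n)) := by ring
      _ ≤ 8 * (2 * √5) * (c₁ ^ 3 / (v * n)) := by gcongr; norm_num
      _ = _ := by ring

end Main

end

end WignerCLT

/-! ### Transfer from gaussian variables to the random matrix -/

theorem mainTheorem6 {Ω Ω' : Type*} [MeasurableSpace Ω] [MeasurableSpace Ω']
    (P : Measure Ω) [IsProbabilityMeasure P] (Q : Measure Ω') [IsProbabilityMeasure Q]
    (n : ℕ) (hn : 1 ≤ n) (c₁ c₂ : ℝ) (hc₁ : 0 ≤ c₁) (hc₂ : 0 ≤ c₂)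
    (X : WignerCLT.UpperIndex n → Ω → ℝ)
    (hXm : ∀ u, Measurable (X u)) (hXind : iIndepFun X P)
    (hXlaw : ∀ u, P.map (X u) ∈ WignerCLT.lawClass c₁ c₂)
    (f : ℂ → ℂ) (hf : Differentiable ℂ f)
    (A : Ω → Matrix (Fin n) (Fin n) ℂ)
    (hA : ∀ ω, A ω = WignerCLT.wignerMatrix n (fun u => X u ω))
    (a b : ℝ≥0∞)
    (ha : a = (∫⁻ ω, ENNReal.ofReal (WignerCLT.f₁ f (WignerCLT.specRadius (A ω))) ^ 4 ∂P)
      ^ (1 / 4 : ℝ))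
    (hb : b = (∫⁻ ω, ENNReal.ofReal (WignerCLT.f₂ f (WignerCLT.specRadius (A ω))) ^ 4 ∂P)
      ^ (1 / 4 : ℝ))
    (W : Ω → ℝ) (hW : ∀ ω, W ω = WignerCLT.linStat f (A ω)) (hW4 : MemLp W 4 P)
    (Z : Ω' → ℝ) (hZ : HasLaw Z (gaussianReal (∫ ω, W ω ∂P) (variance W P).toNNReal) Q) :
    WignerCLT.tvDist (P.map W) (Q.map Z) ≤
      ENNReal.ofReal (2 * √5 / variance W P) *
        (ENNReal.ofReal (4 * c₁ * c₂) * a ^ 2 / ENNReal.ofReal √(n : ℝ) +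
          ENNReal.ofReal (8 * c₁ ^ 3) * a * b / (n : ℝ≥0∞)) := by
  have : NeZero n := ⟨by omega⟩
  have hW2 : MemLp W 2 P := hW4.mono_exponent (by norm_num)
  rw [hZ.map_eq]
  rcases (variance_nonneg W P).eq_or_lt with hv | hv
  · have hconst : P.map W = Measure.dirac (∫ ω, W ω ∂P) := by
      have hae := ae_eq_integral_of_variance_eq_zero hW2 hv.symm
      rw [Measure.map_congr hae, Measure.map_const, measure_univ, one_smul]
    rw [hconst, ← hv, Real.toNNReal_zero, gaussianReal_zero_var, WignerCLT.tvDist_self]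
    exact bot_le
  -- Both sides depend only on the joint law of the entries, and by independence this is the image
  -- of a standard gaussian vector under coordinatewise application of the u_k.
  choose u hu hu1 hu2 hlaw using hXlaw
  have hcm : Continuous (WignerCLT.coordMap u) := (WignerCLT.contDiff_coordMap hu).continuous
  have hXv : Measurable fun ω (k : WignerCLT.UpperIndex n) => X k ω := measurable_pi_lambda _ hXm
  have hmap : P.map (fun ω k => X k ω) =
      (WignerCLT.stdGaussianPi (WignerCLT.UpperIndex n)).map (WignerCLT.coordMap u) := by
    rw [(iIndepFun_iff_map_fun_eq_pi_map fun k => (hXm k).aemeasurable).1 hXind]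
    have hprob : ∀ k, IsProbabilityMeasure ((gaussianReal 0 1).map (u k)) := fun k =>
      Measure.isProbabilityMeasure_map (hu k).continuous.aemeasurable
    simp_rw [hlaw]
    exact (Measure.pi_map_pi fun k => (hu k).continuous.aemeasurable).symm
  have hlin := WignerCLT.continuous_linStat_wignerMatrix (n := n) hf
  have hWeq : W = (fun x => WignerCLT.linStat f (WignerCLT.wignerMatrix n x)) ∘
      fun ω k => X k ω := by
    ext ω; simp only [hW, hA, Function.comp_apply]
  have hid : IdentDistrib W (WignerCLT.gaussStat f u) P
      (WignerCLT.stdGaussianPi (WignerCLT.UpperIndex n)) := by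
    have h0 : IdentDistrib (fun ω k => X k ω) (WignerCLT.coordMap u) P
        (WignerCLT.stdGaussianPi (WignerCLT.UpperIndex n)) :=
      ⟨hXv.aemeasurable, hcm.aemeasurable, hmap⟩
    rw [hWeq]
    exact h0.comp hlin.measurable
  have transfer : ∀ F : (WignerCLT.UpperIndex n → ℝ) → ℝ≥0∞, Measurable F →
      ∫⁻ ω, F (fun k => X k ω) ∂P = ∫⁻ x, F (WignerCLT.coordMap u x)
        ∂WignerCLT.stdGaussianPi (WignerCLT.UpperIndex n) := fun F hF => by
    rw [← lintegral_map hF hXv, hmap, lintegral_map hF hcm.measurable]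
  simp only [hA] at ha hb
  rw [transfer _ ((WignerCLT.measurable_f₁_specRadius hf).ennreal_ofReal.pow_const 4)] at ha
  rw [transfer _ ((WignerCLT.measurable_f₂_specRadius hf).ennreal_ofReal.pow_const 4)] at hb
  refine le_trans ?_ (WignerCLT.ofReal_mul_le_bound hn hc₁ hc₂ hv a b)
  rw [hid.variance_eq] at hv ⊢
  rw [hid.integral_eq, hid.map_eq]
  exact WignerCLT.tvDist_gaussStat_le hf hc₁ hc₂ hu hu1 hu2 ha hb rfl
    (hid.memLp_iff.1 hW2) hv
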